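/- Let $1\le p<\infty$ and let $\mathcal H=\mathcal H_+\oplus\mathcal H_-$ be a complex separable Hilbert space, decomposed into two infinite-dimensional closed orthogonal subspaces. For Hilbert spaces $\mathcal H_1,\mathcal H_2$ let $L_p(\mathcal H_1,\mathcal H_2)$ be the Schatten class of bounded operators $A:\mathcal H_1\to\mathcal H_2$ with $\mathrm{Tr}\,(A^*A)^{p/2}<\infty$, with the norm $\|A\|_p=(\mathrm{Tr}\,(A^*A)^{p/2})^{1/p}$. For a closed subspace $V$ let $\mathrm{pr}_V$ be the orthogonal projection onto $V$, and $\mathrm{pr}_\pm=\mathrm{pr}_{\mathcal H_\pm}$. Let $\mathrm{Gr}_{\mathrm{res},p}(\mathcal H)$ be the set of all closed subspaces $V\subseteq\mathcal H$ such that $\mathrm{pr}_+|_V:V\to\mathcal H_+$ is Fredholm and $\mathrm{pr}_-|_V:V\to\mathcal H_-$ is of class $L_p$. For $V\in\mathrm{Gr}_{\mathrm{res},p}(\mathcal H)$ let $\Omega_V$ be the set of all $W\in\mathrm{Gr}_{\mathrm{res},p}(\mathcal H)$ such that $\mathrm{pr}_V|_W:W\to V$ is an isomorphism. Then $\mathrm{Gr}_{\mathrm{res},p}(\mathcal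 H)$ is a (Hausdorff, complex) analytic Banach manifold modeled on the Banach spaces $L_p(V,V^\perp)$, $V\in\mathrm{Gr}_{\mathrm{res},p}(\mathcal H)$. More precisely, each $L_p(V,V^\perp)$ is complete, and there is a Hausdorff topology on $\mathrm{Gr}_{\mathrm{res},p}(\mathcal H)$ for which the sets $\Omega_V$ form an open cover and the maps $$\varphi_V:\Omega_V\to L_p(V,V^\perp),\qquad \varphi_V(W)=\mathrm{pr}_{V^\perp}\mathrm{pr}_W\mathrm{pr}_V\,(\mathrm{pr}_V\mathrm{pr}_W\mathrm{pr}_V)^{-1},$$ are well defined ($\mathrm{pr}_V\mathrm{pr}_W\mathrm{pr}_V$ is invertible as an operator on $V$ for $W\in\Omega_V$) and are homeomorphisms onto $L_p(V,V^\perp)$, with inverse $A\mapsto\mathrm{graph}(A)=\{x+Ax: x\in V\}$. For $E,V\in\mathrm{Gr}_{\mathrm{res},p}(\mathcal H)$ write $$\mathrm{id}_{\mathcal H}=\begin{pmatrix}a&b\\c&d\end{pmatrix}:E\oplus E^\perp\to V\oplus V^\perp .$$ Then $\varphi_E(\Omega_E\cap\Omega_V)=\{A\in L_p(E,E^\perp):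 a+bA:E\to V\text{ is invertible}\}$ is open in $L_p(E,E^\perp)$, and the transition map $\varphi_V\circ\varphi_E^{-1}$ on this set is analytic and given by $$A\mapsto (c+dA)(a+bA)^{-1}.$$ -/

import Mathlib

set_option linter.unusedSectionVars false

noncomputable section

namespace Schatten

open ContinuousLinearMap
open scoped ENNReal NNReal InnerProductSpace

universe u v
variable {E : Type u} {F : Type v} [NormedAddCommGroup E] [InnerProductSpace ℂ E] [CompleteSpace E]
  [NormedAddCommGroup F] [InnerProductSpace ℂ F] [CompleteSpace F]

/-! ### Schatten classes -/

/-- The trace `∑ i, ⟪b i, T (b i)⟫ ∈ [0, ∞]` of a bounded operator `T ≥ 0`, for a Hilbert basis `b`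
(by Parseval's identity the value does not depend on `b`). -/
def traceNonneg (T : E →L[ℂ] E) : ℝ≥0∞ :=
  ∑' i, ENNReal.ofReal (RCLike.re
    ⟪(exists_hilbertBasis ℂ E).choose_spec.choose i,
      T ((exists_hilbertBasis ℂ E).choose_spec.choose i)⟫_ℂ)

/-- `Tr ((A* A) ^ (p / 2)) ∈ [0, ∞]`, the power being taken in the continuous functional calculus.
-/
def schattenTrace (p : ℝ) (A : E →L[ℂ] F) : ℝ≥0∞ :=
  traceNonneg ((adjoint A ∘L A) ^ (p / 2))

/-- `A` is of Schatten class `L_p`, i.e. `Tr ((A* A) ^ (p / 2)) < ∞`. -/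
def MemSchatten (p : ℝ) (A : E →L[ℂ] F) : Prop := schattenTrace p A < ∞

/-- The Schatten norm `(Tr ((A* A) ^ (p / 2))) ^ (1 / p)`. -/
def schattenNorm (p : ℝ) (A : E →L[ℂ] F) : ℝ := (schattenTrace p A).toReal ^ (1 / p)

/-! ### Auxiliary facts: the Schatten norm is a norm -/

theorem cfc_eigen (T : E →L[ℂ] E) (hT : 0 ≤ T) (v : E) (t : ℝ≥0)
    (hv : T v = ((t : ℝ) : ℂ) • v) {s : ℝ} (hs : 0 < s) :
    (T ^ s) v = (((t ^ s : ℝ≥0) : ℝ) : ℂ) • v := by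
  rcases eq_or_ne v 0 with rfl | hv0
  · simp
  have hsa : IsSelfAdjoint T := hT.isSelfAdjoint
  have hmem : (t : ℝ) ∈ spectrum ℝ T := by
    have h : ((t : ℝ) : ℂ) ∈ spectrum ℂ T := by
      rw [spectrum.mem_iff]
      intro hu
      have h0 : (algebraMap ℂ (E →L[ℂ] E) ((t : ℝ) : ℂ) - T) v = 0 := by
        simp [Algebra.algebraMap_eq_smul_one, hv]
      obtain ⟨w, hw⟩ := hu
      apply hv0
      have : (w⁻¹.val * w.val) v = 0 := by
        change w⁻¹.val (w.val v) = 0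
        rw [hw, h0, map_zero]
      simpa using this
    exact spectrum.of_algebraMap_mem ℂ h
  rw [CFC.rpow_eq_cfc_real hT]
  have key : ∀ f : C(spectrum ℝ T, ℝ),
      (cfcHom (R := ℝ) hsa f) v = ((f ⟨t, hmem⟩ : ℝ) : ℂ) • v := by
    intro f
    induction f using ContinuousMap.induction_on_of_compact with
    | const r =>
      have := AlgHomClass.commutes (cfcHom (R := ℝ) hsa) r
      have h2 : ContinuousMap.const (spectrum ℝ T) r = algebraMap ℝ C(spectrum ℝ T, ℝ) r := rfl
      rw [h2, this]
      simp [Algebra.algebraMap_eq_smul_one]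
    | id =>
      have h2 := cfcHom_id (R := ℝ) hsa
      rw [h2]; simpa using hv
    | star_id =>
      have h2 := cfcHom_id (R := ℝ) hsa
      rw [star_trivial, h2]; simpa using hv
    | add f g hf hg => simp [map_add, hf, hg, add_smul]
    | mul f g hf hg =>
      rw [map_mul]
      change (cfcHom (R := ℝ) hsa f) ((cfcHom (R := ℝ) hsa g) v) = _
      rw [hg, map_smul, hf, smul_smul, ContinuousMap.mul_apply, Complex.ofReal_mul, mul_comm]
    | frequently f hf =>
      have hc : IsClosed {g : C(spectrum ℝ T, ℝ) |
          (cfcHom (R := ℝ) hsa g) v = ((g ⟨t, hmem⟩ : ℝ) : ℂ) • v} := by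
        apply isClosed_eq
        · have := cfcHom_continuous (R := ℝ) hsa
          fun_prop
        · fun_prop
      exact hc.closure_subset (mem_closure_iff_frequently.mpr hf)
  have hcont : ContinuousOn (fun x : ℝ => x ^ s) (spectrum ℝ T) :=
    (Real.continuous_rpow_const hs.le).continuousOn
  rw [cfc_apply _ T hsa hcont, key]
  simp

theorem parseval {ι : Type*} (b : HilbertBasis ι ℂ E) (x : E) :
    ∑' i, ‖⟪b i, x⟫_ℂ‖ₑ ^ 2 = ‖x‖ₑ ^ 2 := by
  have h := b.hasSum_inner_mul_inner x x
  have h2 : HasSum (fun i => ‖⟪b i, x⟫_ℂ‖ ^ 2) (‖x‖ ^ 2) := by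
    have := Complex.hasSum_re h
    convert this using 1
    · ext i
      have := inner_mul_symm_re_eq_norm (𝕜 := ℂ) x (b i)
      rw [RCLike.re_eq_complex_re] at this
      rw [this, norm_mul, norm_inner_symm]; ring
    · exact (inner_self_eq_norm_sq (𝕜 := ℂ) x).symm
  have h3 : ∀ r : ℂ, ‖r‖ₑ ^ 2 = ENNReal.ofReal (‖r‖ ^ 2) := fun r => by
    rw [← ofReal_norm, ENNReal.ofReal_pow (norm_nonneg _)]
  simp_rw [h3]
  rw [← ENNReal.ofReal_tsum_of_nonneg (fun _ => by positivity) h2.summable, h2.tsum_eq,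
    ← ofReal_norm, ENNReal.ofReal_pow (norm_nonneg _)]

theorem bessel {ι : Type*} {v : ι → E} (hv : Orthonormal ℂ v) (x : E) :
    ∑' i, ‖⟪v i, x⟫_ℂ‖ₑ ^ 2 ≤ ‖x‖ₑ ^ 2 := by
  have h3 : ∀ r : ℂ, ‖r‖ₑ ^ 2 = ENNReal.ofReal (‖r‖ ^ 2) := fun r => by
    rw [← ofReal_norm, ENNReal.ofReal_pow (norm_nonneg _)]
  simp_rw [h3]
  rw [← ENNReal.ofReal_tsum_of_nonneg (fun _ => by positivity) (hv.inner_products_summable x),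
    ← ofReal_norm, ← ENNReal.ofReal_pow (norm_nonneg _)]
  exact ENNReal.ofReal_le_ofReal (hv.tsum_inner_products_le x)

theorem compact_of_small (B : E →L[ℂ] F)
    (h : ∀ ε : ℝ, 0 < ε → ∃ S : Submodule ℂ E, FiniteDimensional ℂ S ∧
      ∀ x ∈ Sᗮ, ‖B x‖ ≤ ε * ‖x‖) : IsCompactOperator B := by
  have hc := isClosed_setOfPred_isCompactOperator (σ₁₂ := RingHom.id ℂ) (M₁ := E) (M₂ := F)
  refine hc.closure_subset (Metric.mem_closure_iff.mpr fun ε hε => ?_)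
  obtain ⟨S, hS, hSx⟩ := h (ε / 2) (by positivity)
  refine ⟨B ∘L S.starProjection, ?_, ?_⟩
  · have : IsCompactOperator S.orthogonalProjectionOnto :=
      isCompactOperator_of_locallyCompactSpace_dom _
    exact this.clm_comp (B ∘L S.subtypeL)
  · rw [dist_eq_norm]
    refine lt_of_le_of_lt (ContinuousLinearMap.opNorm_le_bound _ (by positivity) fun x => ?_)
      (half_lt_self hε)
    have h1 : (B - B ∘L S.starProjection) x = B (x - S.starProjection x) := by simp
    rw [h1]
    refine (hSx _ (S.sub_starProjection_mem_orthogonal x)).trans ?_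
    gcongr
    have := Sᗮ.norm_starProjection_apply_le x
    rwa [Submodule.starProjection_orthogonal] at this

/-- `u` is a Hilbert basis of eigenvectors of `T` with eigenvalues `t k ≥ 0`. -/
def IsEigenbasis {ι : Type*} (T : E →L[ℂ] E) (u : HilbertBasis ι ℂ E) (t : ι → ℝ≥0) : Prop :=
  ∀ k, T (u k) = ((t k : ℝ) : ℂ) • u k

open scoped ComplexOrder in
theorem exists_eigenbasis (T : E →L[ℂ] E) (hT : 0 ≤ T) (hc : IsCompactOperator T) :
    ∃ (ι : Type u) (u : HilbertBasis ι ℂ E) (t : ι → ℝ≥0), IsEigenbasis T u t := by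
  have hpos := (ContinuousLinearMap.nonneg_iff_isPositive T).mp hT
  have hsym : (T : E →ₗ[ℂ] E).IsSymmetric := hpos.isSymmetric
  have hbot := T.orthogonalComplement_iSup_eigenspaces_eq_bot hc hsym
  have hcl : ∀ μ : ℂ, CompleteSpace (Module.End.eigenspace (T : E →ₗ[ℂ] E) μ) := fun μ => by
    have hh : IsClosed ((Module.End.eigenspace (T : E →ₗ[ℂ] E) μ : Submodule ℂ E) : Set E) := by
      have : ((Module.End.eigenspace (T : E →ₗ[ℂ] E) μ : Submodule ℂ E) : Set E)
          = {x | T x = μ • x} := by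
        ext x; simp
      rw [this]
      exact isClosed_eq (by fun_prop) (by fun_prop)
    exact hh.completeSpace_coe
  choose w b hb using fun μ : ℂ =>
    exists_hilbertBasis ℂ (Module.End.eigenspace (T : E →ₗ[ℂ] E) μ)
  have hon := hsym.orthogonalFamily_eigenspaces.orthonormal_sigma_orthonormal
    (fun μ => (b μ).orthonormal)
  set v : (Σ μ : ℂ, w μ) → E := fun a => ((b a.1 a.2 : _) : E) with hvdef
  have hsp : (Submodule.span ℂ (Set.range v))ᗮ = ⊥ := by
    rw [← le_bot_iff, ← hbot]
    intro x hx
    rw [Submodule.mem_orthogonal] at hx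
    rw [← Submodule.iInf_orthogonal, Submodule.mem_iInf]
    intro μ
    rw [Submodule.mem_orthogonal]
    intro y hy
    have h1 : ∀ i, ⟪((b μ i : _) : E), x⟫_ℂ = 0 := fun i =>
      hx _ (Submodule.subset_span ⟨⟨μ, i⟩, rfl⟩)
    have h2 := ((b μ).hasSum_repr ⟨y, hy⟩).mapL (Submodule.subtypeL _)
    have h3 := h2.mapL (innerSL ℂ x)
    have h5 : HasSum (fun _ : w μ => (0 : ℂ)) ⟪x, y⟫_ℂ := by
      refine Eq.mp (congrArg (fun g => HasSum g ⟪x, y⟫_ℂ) (funext fun i => ?_)) h3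
      have h6 := h1 i
      rw [← inner_conj_symm, map_eq_zero] at h6
      simp [h6]
    rw [← inner_conj_symm, h5.unique hasSum_zero, map_zero]
  let u := HilbertBasis.mkOfOrthogonalEqBot hon hsp
  have hu : ⇑u = v := HilbertBasis.coe_mkOfOrthogonalEqBot _ _
  refine ⟨_, u, fun a => a.1.re.toNNReal, fun a => ?_⟩
  rw [hu]
  have hev : T (v a) = a.1 • v a := Module.End.mem_eigenspace_iff.mp (b a.1 a.2).2
  have hnorm : ⟪v a, v a⟫_ℂ = 1 := by
    have h1 : ‖v a‖ = 1 := hon.1 a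
    rw [inner_self_eq_norm_sq_to_K, h1]; simp
  have hq : ⟪v a, T (v a)⟫_ℂ = a.1 := by rw [hev, inner_smul_right, hnorm, mul_one]
  have hnn : (0 : ℂ) ≤ a.1 := by
    rw [← hq]; exact hpos.inner_nonneg_right (v a)
  rw [hev]
  congr 1
  rw [Complex.nonneg_iff] at hnn
  apply Complex.ext
  · simp [hnn.1]
  · simp [← hnn.2]

theorem enorm_inner_symm (x y : E) : ‖⟪x, y⟫_ℂ‖ₑ = ‖⟪y, x⟫_ℂ‖ₑ := by
  rw [← ofReal_norm, norm_inner_symm, ofReal_norm]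

theorem enorm_sq_eq (z : ℂ) : ‖z‖ₑ ^ 2 = ENNReal.ofReal (‖z‖ ^ 2) := by
  rw [← ofReal_norm, ENNReal.ofReal_pow (norm_nonneg _)]

theorem quad_eq {ι : Type*} {S : E →L[ℂ] E} (hS : 0 ≤ S) {u : HilbertBasis ι ℂ E} {r : ι → ℝ≥0}
    (h : IsEigenbasis S u r) (x : E) :
    ENNReal.ofReal (RCLike.re ⟪x, S x⟫_ℂ) = ∑' k, (r k : ℝ≥0∞) * ‖⟪u k, x⟫_ℂ‖ₑ ^ 2 := by
  have hpos := (ContinuousLinearMap.nonneg_iff_isPositive S).mp hS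
  have h1 := Complex.hasSum_re (u.hasSum_inner_mul_inner x (S x))
  have h2 : HasSum (fun k => (r k : ℝ) * ‖⟪u k, x⟫_ℂ‖ ^ 2) (⟪x, S x⟫_ℂ).re := by
    convert h1 using 1
    ext k
    have h3 : ⟪u k, S x⟫_ℂ = (r k : ℝ) * ⟪u k, x⟫_ℂ := by
      have h4 : ⟪S (u k), x⟫_ℂ = ⟪u k, S x⟫_ℂ := hpos.isSymmetric (u k) x
      rw [← h4, h k, inner_smul_left]; simp
    have := inner_mul_symm_re_eq_norm (𝕜 := ℂ) x (u k)
    rw [RCLike.re_eq_complex_re] at this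
    rw [h3, mul_left_comm, Complex.re_ofReal_mul, this, norm_mul, norm_inner_symm]; ring
  rw [RCLike.re_eq_complex_re, ← h2.tsum_eq,
    ENNReal.ofReal_tsum_of_nonneg (fun _ => by positivity) h2.summable]
  refine tsum_congr fun k => ?_
  rw [ENNReal.ofReal_mul (by positivity), ENNReal.ofReal_coe_nnreal, enorm_sq_eq]

theorem trace_eq {ι κ : Type*} {S : E →L[ℂ] E} (hS : 0 ≤ S) {u : HilbertBasis ι ℂ E}
    {r : ι → ℝ≥0} (h : IsEigenbasis S u r) (b : HilbertBasis κ ℂ E) :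
    ∑' i, ENNReal.ofReal (RCLike.re ⟪b i, S (b i)⟫_ℂ) = ∑' k, (r k : ℝ≥0∞) := by
  simp_rw [quad_eq hS h]
  rw [ENNReal.tsum_comm]
  refine tsum_congr fun k => ?_
  rw [ENNReal.tsum_mul_left]
  have : ∀ i, ‖⟪u k, b i⟫_ℂ‖ₑ = ‖⟪b i, u k⟫_ℂ‖ₑ := fun i => by
    rw [← ofReal_norm, norm_inner_symm, ofReal_norm]
  simp_rw [this, parseval b, ← ofReal_norm, u.orthonormal.1 k]
  simp


theorem adjoint_comp_nonneg (A : E →L[ℂ] F) : 0 ≤ adjoint A ∘L A :=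
  (ContinuousLinearMap.nonneg_iff_isPositive _).mpr (isPositive_adjoint_comp_self A)

theorem schattenTrace_eq {p : ℝ} (hp : 0 < p) {ι : Type*} (A : E →L[ℂ] F)
    {u : HilbertBasis ι ℂ E} {t : ι → ℝ≥0} (h : IsEigenbasis (adjoint A ∘L A) u t) :
    schattenTrace p A = ∑' k, ((t k ^ (p / 2) : ℝ≥0) : ℝ≥0∞) :=
  trace_eq CFC.rpow_nonneg
    (fun k => cfc_eigen _ (adjoint_comp_nonneg A) _ _ (h k) (by positivity)) _

theorem exists_eigenbasis_of_mem {p : ℝ} (hp : 0 < p) {A : E →L[ℂ] F} (hA : MemSchatten p A) :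
    ∃ (ι : Type u) (u : HilbertBasis ι ℂ E) (t : ι → ℝ≥0),
      IsEigenbasis (adjoint A ∘L A) u t := by
  set T := adjoint A ∘L A with hTdef
  have hT : 0 ≤ T := adjoint_comp_nonneg A
  set R : E →L[ℂ] E := T ^ (p / 4) with hRdef
  have hR : 0 ≤ R := CFC.rpow_nonneg
  have hRsym := ((ContinuousLinearMap.nonneg_iff_isPositive R).mp hR).isSymmetric
  have hRR : T ^ (p / 2) = R * R := by
    have h1 := CFC.rpow_rpow_of_exponent_nonneg T (p / 4) 2 (by positivity) (by norm_num) hT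
    have h2 := CFC.rpow_natCast R 2 hR
    rw [← sq, ← h2, hRdef, show (p / 2) = p / 4 * 2 by ring, ← h1]
    norm_num
  set b := (exists_hilbertBasis ℂ E).choose_spec.choose with hb
  have hsum : ∑' i, ‖R (b i)‖ₑ ^ 2 < ∞ := by
    have : schattenTrace p A = ∑' i, ‖R (b i)‖ₑ ^ 2 := by
      unfold schattenTrace traceNonneg
      refine tsum_congr fun i => ?_
      rw [← hb, ← hTdef, hRR]
      change ENNReal.ofReal (RCLike.re ⟪b i, R (R (b i))⟫_ℂ) = _
      have h4 : ⟪R (b i), R (b i)⟫_ℂ = ⟪b i, R (R (b i))⟫_ℂ := hRsym (b i) (R (b i))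
      rw [← h4, inner_self_eq_norm_sq (𝕜 := ℂ), ENNReal.ofReal_pow (norm_nonneg _), ofReal_norm]
    rw [← this]; exact hA
  have hRc : IsCompactOperator R := by
    refine compact_of_small R fun ε hε => ?_
    have h1 := ENNReal.tendsto_tsum_compl_atTop_zero hsum.ne
    have hε2 : (0 : ℝ≥0∞) < ENNReal.ofReal ε ^ 2 := by
      have : (0 : ℝ≥0∞) < ENNReal.ofReal ε := by simpa using hε
      positivity
    obtain ⟨s, hs⟩ := (h1.eventually_le_const hε2).exists
    refine ⟨Submodule.span ℂ ((fun i => R (b i)) '' (s : Set _)), ?_, fun x hx => ?_⟩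
    · exact FiniteDimensional.span_of_finite ℂ (s.finite_toSet.image _)
    · have h0 : ∀ i ∈ s, ⟪R (b i), x⟫_ℂ = 0 := fun i hi =>
        (Submodule.mem_orthogonal _ _).mp hx _ (Submodule.subset_span ⟨i, hi, rfl⟩)
      have hle : ‖R x‖ₑ ^ 2 ≤ (ENNReal.ofReal ε * ‖x‖ₑ) ^ 2 := by
        rw [← parseval b (R x)]
        have h4 : ∀ i, ⟪b i, R x⟫_ℂ = ⟪R (b i), x⟫_ℂ := fun i => (hRsym (b i) x).symm
        simp_rw [h4]
        have h5 : Function.support (fun i => ‖⟪R (b i), x⟫_ℂ‖ₑ ^ 2) ⊆ {i | i ∉ s} := by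
          intro i hi his
          simp [h0 i his] at hi
        rw [← tsum_subtype_eq_of_support_subset h5, mul_pow]
        calc _ ≤ ∑' i : {i // i ∉ s}, ‖R (b i)‖ₑ ^ 2 * ‖x‖ₑ ^ 2 := by
              refine ENNReal.tsum_le_tsum fun i => ?_
              rw [← mul_pow]
              gcongr
              rw [← ofReal_norm, ← ofReal_norm, ← ofReal_norm, ← ENNReal.ofReal_mul (norm_nonneg _)]
              exact ENNReal.ofReal_le_ofReal (norm_inner_le_norm _ _)
          _ = (∑' i : {i // i ∉ s}, ‖R (b i)‖ₑ ^ 2) * ‖x‖ₑ ^ 2 := ENNReal.tsum_mul_right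
          _ ≤ _ := by gcongr
      have h6 := (ENNReal.pow_le_pow_left_iff two_ne_zero).mp hle
      rw [← ofReal_norm, ← ofReal_norm, ← ENNReal.ofReal_mul hε.le] at h6
      exact (ENNReal.ofReal_le_ofReal_iff (by positivity)).mp h6
  obtain ⟨ι, u, r, hu⟩ := exists_eigenbasis R hR hRc
  refine ⟨ι, u, fun k => r k ^ (4 / p), fun k => ?_⟩
  have h1 := cfc_eigen R hR _ _ (hu k) (s := 4 / p) (by positivity)
  have h2 := CFC.rpow_rpow_of_exponent_nonneg T (p / 4) (4 / p) (by positivity) (by positivity) hT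
  rw [← hRdef, show p / 4 * (4 / p) = 1 by field_simp, CFC.rpow_one T hT] at h2
  rw [← h2]
  exact h1

theorem enorm_apply_sq {ι : Type*} (A : E →L[ℂ] F) {u : HilbertBasis ι ℂ E} {t : ι → ℝ≥0}
    (h : IsEigenbasis (adjoint A ∘L A) u t) (x : E) :
    ‖A x‖ₑ ^ 2 = ∑' k, (t k : ℝ≥0∞) * ‖⟪u k, x⟫_ℂ‖ₑ ^ 2 := by
  rw [← quad_eq (adjoint_comp_nonneg A) h x]
  change _ = ENNReal.ofReal (RCLike.re ⟪x, adjoint A (A x)⟫_ℂ)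
  rw [adjoint_inner_right, inner_self_eq_norm_sq (𝕜 := ℂ), ENNReal.ofReal_pow (norm_nonneg _),
    ofReal_norm]

theorem isCompactOperator_of_mem {p : ℝ} (hp : 0 < p) {A : E →L[ℂ] F} (hA : MemSchatten p A) :
    IsCompactOperator A := by
  obtain ⟨ι, u, t, h⟩ := exists_eigenbasis_of_mem hp hA
  have hfin : ∑' k, ((t k ^ (p / 2) : ℝ≥0) : ℝ≥0∞) ≠ ∞ := by
    rw [← schattenTrace_eq hp A h]; exact hA.ne
  refine compact_of_small A fun ε hε => ?_
  set e : ℝ≥0 := ε.toNNReal with he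
  have hepos : 0 < e := by simpa [he] using hε
  have h1 := ENNReal.tendsto_cofinite_zero_of_tsum_ne_top hfin
  have hlt : (0 : ℝ≥0∞) < (((e ^ 2) ^ (p / 2) : ℝ≥0) : ℝ≥0∞) := by
    have : 0 < (e ^ 2) ^ (p / 2) := NNReal.rpow_pos (by positivity)
    exact_mod_cast this
  have h2 := h1.eventually_le_const hlt
  rw [Filter.eventually_cofinite] at h2
  refine ⟨Submodule.span ℂ (u '' _), FiniteDimensional.span_of_finite ℂ (h2.image u),
    fun x hx => ?_⟩
  have h0 : ∀ k, ¬ t k ≤ e ^ 2 → ⟪u k, x⟫_ℂ = 0 := fun k hk =>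
    (Submodule.mem_orthogonal _ _).mp hx _ (Submodule.subset_span ⟨k, by
      change ¬ _
      intro hk2
      apply hk
      rw [ENNReal.coe_le_coe] at hk2
      exact (NNReal.rpow_le_rpow_iff (by positivity)).mp hk2, rfl⟩)
  have hle : ‖A x‖ₑ ^ 2 ≤ ((e : ℝ≥0∞) * ‖x‖ₑ) ^ 2 := by
    rw [enorm_apply_sq A h x, mul_pow, ← parseval u x, ← ENNReal.tsum_mul_left]
    refine ENNReal.tsum_le_tsum fun k => ?_
    by_cases hk : t k ≤ e ^ 2
    · gcongr
      exact_mod_cast hk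
    · simp [h0 k hk]
  have h6 := (ENNReal.pow_le_pow_left_iff two_ne_zero).mp hle
  rw [← ofReal_norm, ← ofReal_norm, show (e : ℝ≥0∞) = ENNReal.ofReal ε from rfl,
    ← ENNReal.ofReal_mul hε.le] at h6
  exact (ENNReal.ofReal_le_ofReal_iff (by positivity)).mp h6


theorem jensen {ι : Type*} {p : ℝ} (hp : 1 ≤ p) (w f : ι → ℝ≥0∞) (hw : ∑' i, w i ≤ 1) :
    (∑' i, w i * f i) ^ p ≤ ∑' i, w i * f i ^ p := by
  have hp0 : 0 < p := by linarith
  rw [← ENNReal.le_rpow_inv_iff hp0]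
  rw [ENNReal.tsum_eq_iSup_sum]
  refine iSup_le fun s => ?_
  refine (ENNReal.inner_le_weight_mul_Lp_of_nonneg s hp w f).trans ?_
  have h1 : (∑ i ∈ s, w i) ^ (1 - p⁻¹) ≤ 1 :=
    ENNReal.rpow_le_one ((ENNReal.sum_le_tsum s).trans hw)
      (sub_nonneg.mpr (inv_le_one_of_one_le₀ hp))
  calc _ ≤ 1 * (∑ i ∈ s, w i * f i ^ p) ^ p⁻¹ := by gcongr
    _ ≤ _ := by
      rw [one_mul]
      gcongr
      exact ENNReal.sum_le_tsum s

theorem minkowski {ι : Type*} {p : ℝ} (hp : 1 ≤ p) (f g : ι → ℝ≥0∞) :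
    (∑' i, (f i + g i) ^ p) ^ (1 / p) ≤ (∑' i, f i ^ p) ^ (1 / p) + (∑' i, g i ^ p) ^ (1 / p) := by
  have hp0 : 0 < p := by linarith
  rw [one_div, ENNReal.rpow_inv_le_iff hp0]
  rw [ENNReal.tsum_eq_iSup_sum]
  refine iSup_le fun s => ?_
  rw [← ENNReal.rpow_inv_le_iff hp0, ← one_div]
  refine (ENNReal.Lp_add_le s f g hp).trans ?_
  gcongr <;> exact ENNReal.sum_le_tsum s

/-- The vectors `A (u k) / √(t k)` (zero when `t k = 0`). -/
def polarVec {ι : Type*} (A : E →L[ℂ] F) (u : HilbertBasis ι ℂ E) (t : ι → ℝ≥0) (k : ι) : F :=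
  (((NNReal.sqrt (t k) : ℝ) : ℂ)⁻¹) • A (u k)

section polar
variable {ι : Type*} {A : E →L[ℂ] F} {u : HilbertBasis ι ℂ E} {t : ι → ℝ≥0}

theorem inner_apply_apply (h : IsEigenbasis (adjoint A ∘L A) u t) (k l : ι) :
    ⟪A (u k), A (u l)⟫_ℂ = ((t l : ℝ) : ℂ) * ⟪u k, u l⟫_ℂ := by
  rw [← adjoint_inner_right, show adjoint A (A (u l)) = (adjoint A ∘L A) (u l) from rfl, h l,
    inner_smul_right]

theorem sqrt_smul_polarVec (h : IsEigenbasis (adjoint A ∘L A) u t) (k : ι) :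
    ((NNReal.sqrt (t k) : ℝ) : ℂ) • polarVec A u t k = A (u k) := by
  by_cases hk : t k = 0
  · have h1 := inner_apply_apply h k k
    rw [hk] at h1
    simp only [NNReal.coe_zero, Complex.ofReal_zero, zero_mul, inner_self_eq_zero] at h1
    simp [hk, h1]
  · rw [polarVec, smul_inv_smul₀]
    simpa using hk

theorem orthonormal_polarVec (h : IsEigenbasis (adjoint A ∘L A) u t) :
    Orthonormal ℂ fun k : {k // t k ≠ 0} => polarVec A u t k := by
  classical
  rw [orthonormal_iff_ite]
  rintro ⟨k, hk⟩ ⟨l, hl⟩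
  simp only [polarVec, inner_smul_left, inner_smul_right, inner_apply_apply h,
    orthonormal_iff_ite.mp u.orthonormal k l, Subtype.mk.injEq]
  split_ifs with hkl
  · subst hkl
    have h1 : ((t k : ℝ) : ℂ) = ((NNReal.sqrt (t k) : ℝ) : ℂ) * ((NNReal.sqrt (t k) : ℝ) : ℂ) := by
      rw [← Complex.ofReal_mul, ← NNReal.coe_mul, NNReal.mul_self_sqrt]
    have h2 : ((NNReal.sqrt (t k) : ℝ) : ℂ) ≠ 0 := by simpa using hk
    rw [map_inv₀, Complex.conj_ofReal, h1]
    field_simp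
  · simp

theorem inner_polarVec (h : IsEigenbasis (adjoint A ∘L A) u t) (k : ι) :
    ⟪polarVec A u t k, A (u k)⟫_ℂ = ((NNReal.sqrt (t k) : ℝ) : ℂ) := by
  by_cases hk : t k = 0
  · simp [polarVec, hk]
  · have h1 := (orthonormal_polarVec h).1 ⟨k, hk⟩
    rw [← sqrt_smul_polarVec h k, inner_smul_right, inner_self_eq_norm_sq_to_K]
    simp only at h1
    simp [h1]

theorem bessel_polarVec (h : IsEigenbasis (adjoint A ∘L A) u t) (y : F) :
    ∑' k, ‖⟪polarVec A u t k, y⟫_ℂ‖ₑ ^ 2 ≤ ‖y‖ₑ ^ 2 := by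
  have h1 : Function.support (fun k => ‖⟪polarVec A u t k, y⟫_ℂ‖ₑ ^ 2) ⊆ {k | t k ≠ 0} := by
    intro k hk hk0
    simp [polarVec, hk0] at hk
  rw [← tsum_subtype_eq_of_support_subset h1]
  exact bessel (orthonormal_polarVec h) y

theorem pairing_le (h : IsEigenbasis (adjoint A ∘L A) u t) {p : ℝ} (hp : 1 ≤ p) {J : Type*} {e : J → E} {f : J → F}
    (he : Orthonormal ℂ e) (hf : Orthonormal ℂ f) :
    ∑' j, ‖⟪f j, A (e j)⟫_ℂ‖ₑ ^ p ≤ schattenTrace p A := by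
  have hp0 : 0 < p := by linarith
  set w : J → ι → ℝ≥0∞ := fun j k =>
    2⁻¹ * (‖⟪u k, e j⟫_ℂ‖ₑ ^ 2 + ‖⟪polarVec A u t k, f j⟫_ℂ‖ₑ ^ 2) with hw
  have hw1 : ∀ j, ∑' k, w j k ≤ 1 := fun j => by
    rw [ENNReal.tsum_mul_left, ENNReal.tsum_add, parseval u]
    have h1 := bessel_polarVec h (f j)
    have h2 : ‖e j‖ₑ = 1 := by rw [← ofReal_norm, he.1 j]; simp
    have h3 : ‖f j‖ₑ = 1 := by rw [← ofReal_norm, hf.1 j]; simp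
    rw [h3] at h1
    rw [h2]
    calc _ ≤ (2 : ℝ≥0∞)⁻¹ * (1 ^ 2 + 1 ^ 2) := by gcongr
      _ = 1 := by
        rw [one_pow, one_add_one_eq_two]
        exact ENNReal.inv_mul_cancel (by norm_num) (by norm_num)
  have hnv : ∀ k, ‖polarVec A u t k‖ₑ ≤ 1 := fun k => by
    by_cases hk : t k = 0
    · simp [polarVec, hk]
    · rw [← ofReal_norm, (orthonormal_polarVec h).1 ⟨k, hk⟩]; simp
  have hw2 : ∀ k, ∑' j, w j k ≤ 1 := fun k => by
    rw [ENNReal.tsum_mul_left, ENNReal.tsum_add]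
    simp_rw [enorm_inner_symm (u k), enorm_inner_symm (polarVec A u t k)]
    have h1 := bessel he (u k)
    have h2 := bessel hf (polarVec A u t k)
    have h3 : ‖u k‖ₑ = 1 := by rw [← ofReal_norm, u.orthonormal.1 k]; simp
    calc _ ≤ (2 : ℝ≥0∞)⁻¹ * (1 ^ 2 + 1 ^ 2) := by
          gcongr
          · rwa [h3] at h1
          · exact h2.trans (by gcongr; exact hnv k)
      _ = 1 := by
        rw [one_pow, one_add_one_eq_two]
        exact ENNReal.inv_mul_cancel (by norm_num) (by norm_num)
  have hamgm : ∀ a b : ℝ≥0, (a : ℝ≥0∞) * b ≤ 2⁻¹ * ((a : ℝ≥0∞) ^ 2 + (b : ℝ≥0∞) ^ 2) := by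
    intro a b
    have h1 : a * b ≤ 2⁻¹ * (a ^ 2 + b ^ 2) := by
      rw [← NNReal.coe_le_coe]
      push_cast
      nlinarith [sq_nonneg ((a : ℝ) - b)]
    have h2 : ((2⁻¹ : ℝ≥0) : ℝ≥0∞) = 2⁻¹ := by simp
    rw [← h2]
    exact_mod_cast h1
  have hterm : ∀ j, ‖⟪f j, A (e j)⟫_ℂ‖ₑ ≤ ∑' k, w j k * (NNReal.sqrt (t k) : ℝ≥0∞) := fun j => by
    have h1 := ((u.hasSum_repr (e j)).mapL A).mapL (innerSL ℂ (f j))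
    have h2 : ⟪f j, A (e j)⟫_ℂ = ∑' k, ⟪f j, A (u.repr (e j) k • u k)⟫_ℂ := h1.tsum_eq.symm
    rw [h2]
    refine enorm_tsum_le_tsum_enorm.trans (ENNReal.tsum_le_tsum fun k => ?_)
    rw [map_smul, ← sqrt_smul_polarVec h k, inner_smul_right, inner_smul_right, enorm_mul,
      enorm_mul, u.repr_apply_apply, enorm_inner_symm (f j)]
    have h3 : ‖((NNReal.sqrt (t k) : ℝ) : ℂ)‖ₑ = (NNReal.sqrt (t k) : ℝ≥0∞) := by
      rw [← ofReal_norm, Complex.norm_real, Real.norm_of_nonneg (NNReal.coe_nonneg _),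
        ENNReal.ofReal_coe_nnreal]
    rw [h3, mul_left_comm, mul_comm]
    gcongr
    exact hamgm _ _
  calc _ ≤ ∑' j, (∑' k, w j k * (NNReal.sqrt (t k) : ℝ≥0∞)) ^ p := by
        refine ENNReal.tsum_le_tsum fun j => ?_
        gcongr
        exact hterm j
    _ ≤ ∑' j, ∑' k, w j k * (NNReal.sqrt (t k) : ℝ≥0∞) ^ p :=
        ENNReal.tsum_le_tsum fun j => jensen hp _ _ (hw1 j)
    _ = ∑' k, (∑' j, w j k) * (NNReal.sqrt (t k) : ℝ≥0∞) ^ p := by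
        rw [ENNReal.tsum_comm]
        exact tsum_congr fun k => ENNReal.tsum_mul_right
    _ ≤ ∑' k, 1 * (NNReal.sqrt (t k) : ℝ≥0∞) ^ p := by
        refine ENNReal.tsum_le_tsum fun k => ?_
        gcongr
        exact hw2 k
    _ = _ := by
        rw [schattenTrace_eq hp0 A h]
        refine tsum_congr fun k => ?_
        rw [one_mul, ← ENNReal.coe_rpow_of_nonneg _ hp0.le, NNReal.sqrt_eq_rpow, ← NNReal.rpow_mul]
        congr 2
        ring

end polar

theorem schattenTrace_add_le {p : ℝ} (hp : 1 ≤ p) {A B : E →L[ℂ] F} (hA : MemSchatten p A)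
    (hB : MemSchatten p B) :
    schattenTrace p (A + B) ^ (1 / p) ≤ schattenTrace p A ^ (1 / p) + schattenTrace p B ^ (1 / p) := by
  have hp0 : 0 < p := by linarith
  obtain ⟨_, _, _, hTA⟩ := exists_eigenbasis_of_mem hp0 hA
  obtain ⟨_, _, _, hTB⟩ := exists_eigenbasis_of_mem hp0 hB
  have hcC : IsCompactOperator (A + B) :=
    (isCompactOperator_of_mem hp0 hA).add (isCompactOperator_of_mem hp0 hB)
  obtain ⟨ι, u, t, h⟩ := exists_eigenbasis (adjoint (A + B) ∘L (A + B)) (adjoint_comp_nonneg _)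
    (hcC.clm_comp (adjoint (A + B)))
  have hpv := orthonormal_polarVec h
  have hu : Orthonormal ℂ fun k : {k // t k ≠ 0} => u k :=
    u.orthonormal.comp _ Subtype.val_injective
  have h1 : schattenTrace p (A + B) =
      ∑' k : {k // t k ≠ 0}, ‖⟪polarVec (A + B) u t k, (A + B) (u k)⟫_ℂ‖ₑ ^ p := by
    have h2 : Function.support (fun k => ‖⟪polarVec (A + B) u t k, (A + B) (u k)⟫_ℂ‖ₑ ^ p)
        ⊆ {k | t k ≠ 0} := by
      intro k hk hk0
      simp [polarVec, hk0, hp0] at hk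
    rw [schattenTrace_eq hp0 _ h]
    refine Eq.trans ?_ (tsum_subtype_eq_of_support_subset h2).symm
    refine tsum_congr fun k => ?_
    rw [inner_polarVec h, ← ofReal_norm, Complex.norm_real,
      Real.norm_of_nonneg (NNReal.coe_nonneg _), ENNReal.ofReal_coe_nnreal,
      ← ENNReal.coe_rpow_of_nonneg _ hp0.le, NNReal.sqrt_eq_rpow, ← NNReal.rpow_mul]
    congr 2
    ring
  rw [h1]
  calc _ ≤ (∑' k : {k // t k ≠ 0}, (‖⟪polarVec (A + B) u t k, A (u k)⟫_ℂ‖ₑ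
          + ‖⟪polarVec (A + B) u t k, B (u k)⟫_ℂ‖ₑ) ^ p) ^ (1 / p) := by
        gcongr
        rw [add_apply, inner_add_right]
        exact enorm_add_le _ _
    _ ≤ _ := minkowski hp _ _
    _ ≤ _ := by
        gcongr
        · exact pairing_le hTA hp hu hpv
        · exact pairing_le hTB hp hu hpv

theorem schattenTrace_smul {p : ℝ} (hp : 0 < p) (c : ℂ) {A : E →L[ℂ] F} (hA : MemSchatten p A) :
    schattenTrace p (c • A) = ‖c‖ₑ ^ p * schattenTrace p A := by
  obtain ⟨ι, u, t, h⟩ := exists_eigenbasis_of_mem hp hA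
  have h2 : IsEigenbasis (adjoint (c • A) ∘L (c • A)) u (fun k => ‖c‖₊ ^ 2 * t k) := fun k => by
    have h3 : (adjoint (c • A) ∘L (c • A)) (u k) =
        ((starRingEnd ℂ) c * c) • (adjoint A ∘L A) (u k) := by
      have h4 : adjoint (c • A) = (starRingEnd ℂ) c • adjoint A := map_smulₛₗ _ _ _
      rw [h4]
      simp [smul_smul, mul_comm]
    rw [h3, h k, smul_smul]
    congr 1
    rw [mul_comm ((starRingEnd ℂ) c), Complex.mul_conj']
    push_cast
    simp
  rw [schattenTrace_eq hp _ h, schattenTrace_eq hp _ h2, ← ENNReal.tsum_mul_left]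
  refine tsum_congr fun k => ?_
  rw [NNReal.mul_rpow, ENNReal.coe_mul, ← NNReal.rpow_natCast, ← NNReal.rpow_mul,
    show ((2 : ℕ) : ℝ) * (p / 2) = p by push_cast; ring, ENNReal.coe_rpow_of_nonneg _ hp.le]
  rfl

theorem schattenTrace_zero {p : ℝ} (hp : 0 < p) : schattenTrace p (0 : E →L[ℂ] F) = 0 := by
  have h : ((0 : E →L[ℂ] E) ^ (p / 2)) = 0 := CFC.zero_rpow (by positivity)
  simp [schattenTrace, traceNonneg, h]

theorem eq_zero_of_schattenTrace {p : ℝ} (hp : 0 < p) {A : E →L[ℂ] F}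
    (h0 : schattenTrace p A = 0) : A = 0 := by
  obtain ⟨ι, u, t, h⟩ := exists_eigenbasis_of_mem hp (show MemSchatten p A by
    rw [MemSchatten, h0]; simp)
  rw [schattenTrace_eq hp A h, ENNReal.tsum_eq_zero] at h0
  ext x
  have h1 := enorm_apply_sq A h x
  have h2 : ∀ k, t k = 0 := fun k => by
    have := h0 k
    rw [ENNReal.coe_eq_zero, NNReal.rpow_eq_zero_iff] at this
    exact this.1
  simpa [h2] using h1

/-! ### The Schatten class as a normed space -/

section normed
variable (p : ℝ) [hp : Fact (1 ≤ p)]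

theorem MemSchatten.add {p : ℝ} (hp : 1 ≤ p) {A B : E →L[ℂ] F} (hA : MemSchatten p A)
    (hB : MemSchatten p B) : MemSchatten p (A + B) := by
  have hp0 : 0 < p := by linarith
  have h := schattenTrace_add_le hp hA hB
  have h2 : schattenTrace p A ^ (1 / p) + schattenTrace p B ^ (1 / p) < ∞ :=
    ENNReal.add_lt_top.mpr ⟨ENNReal.rpow_lt_top_of_nonneg (by positivity) hA.ne,
      ENNReal.rpow_lt_top_of_nonneg (by positivity) hB.ne⟩
  exact (ENNReal.rpow_lt_top_iff_of_pos (by positivity)).mp (h.trans_lt h2)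

theorem MemSchatten.smul {p : ℝ} (hp : 1 ≤ p) (c : ℂ) {A : E →L[ℂ] F} (hA : MemSchatten p A) :
    MemSchatten p (c • A) := by
  have hp0 : 0 < p := by linarith
  rw [MemSchatten, schattenTrace_smul hp0 c hA]
  exact ENNReal.mul_lt_top (ENNReal.rpow_lt_top_of_nonneg hp0.le enorm_ne_top) hA

variable (E F) in
/-- The linear subspace of `L_p` operators in the space of bounded operators. -/
def schattenSubmodule : Submodule ℂ (E →L[ℂ] F) where
  carrier := {A | MemSchatten p A}
  add_mem' hA hB := MemSchatten.add hp.out hA hB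
  zero_mem' := by
    change schattenTrace p 0 < ∞
    rw [schattenTrace_zero (by linarith [hp.out])]; simp
  smul_mem' c _ hA := MemSchatten.smul hp.out c hA

variable (E F) in
/-- The Schatten class `L_p(E, F)`, `1 ≤ p < ∞`. It carries the Schatten norm (not the
operator norm of the ambient space of bounded operators). -/
def SchattenClass : Type (max u v) := schattenSubmodule E F p

instance : AddCommGroup (SchattenClass E F p) :=
  inferInstanceAs (AddCommGroup (schattenSubmodule E F p))

instance : Module ℂ (SchattenClass E F p) :=
  inferInstanceAs (Module ℂ (schattenSubmodule E F p))

variable {p}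

/-- The bounded operator underlying an element of `L_p(E, F)`. -/
def SchattenClass.toCLM (A : SchattenClass E F p) : E →L[ℂ] F := A.1

variable (p)

instance : Norm (SchattenClass E F p) := ⟨fun A => schattenNorm p A.toCLM⟩

theorem schattenNorm_core : NormedSpace.Core ℂ (SchattenClass E F p) := by
  have hp0 : 0 < p := by linarith [hp.out]
  refine ⟨⟨fun A => ?_, fun c A => ?_, fun A B => ?_⟩, fun A => ⟨fun h => ?_, ?_⟩⟩
  · exact Real.rpow_nonneg ENNReal.toReal_nonneg _
  · change (schattenTrace p (c • A.toCLM)).toReal ^ (1 / p) = ‖c‖ * schattenNorm p A.toCLM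
    have h := schattenTrace_smul hp0 c (A := A.toCLM) A.2
    rw [h, ENNReal.toReal_mul, ← ENNReal.toReal_rpow, toReal_enorm,
      Real.mul_rpow (by positivity) ENNReal.toReal_nonneg, one_div,
      Real.rpow_rpow_inv (norm_nonneg c) hp0.ne', ← one_div]
    rfl
  · change schattenNorm p (A.toCLM + B.toCLM) ≤ schattenNorm p A.toCLM + schattenNorm p B.toCLM
    have h := schattenTrace_add_le hp.out A.2 B.2
    have hA : schattenTrace p A.toCLM ^ (1 / p) ≠ ∞ :=
      ENNReal.rpow_ne_top_of_nonneg (by positivity) A.2.ne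
    have hB : schattenTrace p B.toCLM ^ (1 / p) ≠ ∞ :=
      ENNReal.rpow_ne_top_of_nonneg (by positivity) B.2.ne
    simp only [schattenNorm, ENNReal.toReal_rpow]
    rw [← ENNReal.toReal_add hA hB]
    exact ENNReal.toReal_mono (ENNReal.add_ne_top.mpr ⟨hA, hB⟩) h
  · change (schattenTrace p A.toCLM).toReal ^ (1 / p) = 0 at h
    rw [Real.rpow_eq_zero ENNReal.toReal_nonneg (by positivity), ENNReal.toReal_eq_zero_iff] at h
    have h1 := h.resolve_right A.2.ne
    exact Subtype.ext (eq_zero_of_schattenTrace hp0 h1)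
  · rintro rfl
    change (schattenTrace p (0 : E →L[ℂ] F)).toReal ^ (1 / p) = 0
    rw [schattenTrace_zero hp0]
    simp [hp0.ne']

instance : NormedAddCommGroup (SchattenClass E F p) :=
  NormedAddCommGroup.ofCore (schattenNorm_core p)

instance : NormedSpace ℂ (SchattenClass E F p) := NormedSpace.ofCore (schattenNorm_core p)

theorem SchattenClass.norm_def (A : SchattenClass E F p) : ‖A‖ = schattenNorm p A.toCLM := rfl

end normed

end Schatten

/-! ### Analytic Banach manifolds -/

/-- An analytic Banach manifold structure on the topological space `M`, modeled on the Banach spaces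
`X i`: charts `chart i` which are homeomorphisms from open subsets of `M` onto open subsets of
`X i`, whose domains cover `M`, and whose transition maps are analytic. (Mathlib's `ChartedSpace`
has one model space for all charts.) -/
structure AnalyticBanachAtlas (𝕜 : Type*) [NontriviallyNormedField 𝕜] (M : Type*)
    [TopologicalSpace M] {ι : Type*} (X : ι → Type*) [∀ i, NormedAddCommGroup (X i)]
    [∀ i, NormedSpace 𝕜 (X i)] where
  complete : ∀ i, CompleteSpace (X i)
  chart : ∀ i, OpenPartialHomeomorph M (X i)
  cover : ∀ x, ∃ i, x ∈ (chart i).source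
  analytic_transition : ∀ i j,
    AnalyticOnNhd 𝕜 ((chart i).symm.trans (chart j)) ((chart i).symm.trans (chart j)).source

/-! ### The restricted Grassmannian -/

namespace RestrictedGrassmannian

open Schatten

variable {H : Type*} [NormedAddCommGroup H] [InnerProductSpace ℂ H] [CompleteSpace H]

instance (V : ClosedSubmodule ℂ H) : CompleteSpace V.toSubmodule := V.isClosed.completeSpace_coe

/-- `pr_V|_W : W → V`, the orthogonal projection onto `V` restricted to `W`. -/
def proj (V W : ClosedSubmodule ℂ H) : W.toSubmodule →L[ℂ] V.toSubmodule :=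
  V.toSubmodule.orthogonalProjectionOnto ∘L W.toSubmodule.subtypeL

/-- The restricted `p`-Schatten class Grassmannian of `H = Hp ⊕ Hpᗮ`: the closed subspaces `V` such
that `pr_+|_V : V → Hp` is Fredholm and `pr_-|_V : V → Hpᗮ` is of class `L_p`. -/
def Gr (p : ℝ) (Hp : ClosedSubmodule ℂ H) : Type _ :=
  {V : ClosedSubmodule ℂ H // (proj Hp V).IsFredholm ∧ MemSchatten p (proj Hpᗮ V)}

/-- The Schatten class `L_p(V, Vᗮ)`. -/
abbrev Model (p : ℝ) [Fact (1 ≤ p)] (V : ClosedSubmodule ℂ H) : Type _ :=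
  SchattenClass V.toSubmodule (Vᗮ).toSubmodule p

/-- `Ω_V`: the elements `W` of the Grassmannian such that `pr_V|_W : W → V` is an isomorphism. -/
def Omega {p : ℝ} {Hp : ClosedSubmodule ℂ H} (V : Gr p Hp) : Set (Gr p Hp) :=
  {W | (proj V.1 W.1).IsInvertible}

/-- `pr_V pr_W pr_V`, as an operator on `V`. -/
def chartDenom (V W : ClosedSubmodule ℂ H) : V.toSubmodule →L[ℂ] V.toSubmodule :=
  V.toSubmodule.orthogonalProjectionOnto ∘L W.toSubmodule.starProjection ∘L V.toSubmodule.subtypeL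

/-- `pr_{Vᗮ} pr_W pr_V`, as an operator `V → Vᗮ`. -/
def chartNum (V W : ClosedSubmodule ℂ H) : V.toSubmodule →L[ℂ] (Vᗮ).toSubmodule :=
  (Vᗮ).toSubmodule.orthogonalProjectionOnto ∘L W.toSubmodule.starProjection ∘L
    V.toSubmodule.subtypeL

end RestrictedGrassmannian

end

/-!
The elements of `Ω_V` are the graphs of the `L_p` operators `V → Vᗮ`, and everything is computed
with the restricted projections `proj U W = pr_U|_W`. The identity `pr_U|_V = pr_U|_K pr_K|_V +
pr_U|_Kᗮ pr_Kᗮ|_V` (`proj_comp_proj_add`) carries these computations.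

*The charts.* If `pr_V|_W` is invertible, then `W` is the graph of `pr_Vᗮ|_W (pr_V|_W)⁻¹`
(`eq_graph`), and this operator is the one given by the chart formula, since `pr_V pr_W pr_V =
(pr_V|_W) (pr_W|_V)` and `pr_W|_V` is the adjoint of `pr_V|_W`. Two facts tie graphs to the
Schatten class. First, `pr_Vᗮ|_W` is of class `L_p` for all `V`, `W` in the Grassmannian
(`memSchatten_proj_orthogonal`): `pr_-|_W` is of class `L_p`, and if `Ψ` is a quasi-inverse of
`pr_+|_V`, then modulo finite rank `pr_Vᗮ|_Hp = pr_Vᗮ pr_+ Ψ = -pr_Vᗮ pr_- Ψ`. Secondly, the graph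
of an `L_p` operator `A : V → Vᗮ` is in the Grassmannian (`graphGr`): in the parametrization `x ↦ x
+ A x` the restrictions of `pr_±` are perturbed by `L_p` operators, in particular by compact ones,
which preserve the Fredholm property (`IsFredholm.add_isCompactOperator`).

*The transition maps.* In the parametrization of a graph over `E`, the restrictions of `pr_V` and
`pr_Vᗮ` are `a + b A` and `c + d A`. So the graph of `A` is in `Ω_V` if and only if `a + b A` is
invertible, and the chart at `V` is then `(c + d A) (a + b A)⁻¹`. Here `a + b A` and its inverse
are analytic in the operator norm, `c + d A` is affine with values in `L_p`, and the composition
`L_p × L → L_p` is bounded bilinear, because `L_p` is an operator ideal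
(`schattenTrace_comp_comp_le`).

*The topology.* The Grassmannian carries the finest topology making all `A ↦ graph A` continuous;
as the transition maps are continuous on open sets, these maps are open embeddings. The space is
Hausdorff because `W ↦ pr_W` is a continuous injection into the bounded operators: on a chart `pr_W
= G (G* G)⁻¹ G*` with `G x = x + A x`.

*The ideal property and completeness of `L_p`* both come from the description of the Schatten trace
of a compact operator as the supremum of `∑ |⟪f j, A (e j)⟫| ^ p` over orthonormal families `e`,
`f`. The sums remain bounded by the trace for families that merely satisfy Bessel's inequality,
such as images of orthonormal families under contractions (`pairing_le_of_bessel`), and the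
supremum is lower semicontinuous in the operator norm (`schattenTrace_le_of_tendsto`).
-/

noncomputable section

namespace Schatten

open ContinuousLinearMap
open scoped ENNReal NNReal InnerProductSpace

universe u v w

variable {E : Type u} {F : Type v} [NormedAddCommGroup E] [InnerProductSpace ℂ E] [CompleteSpace E]
  [NormedAddCommGroup F] [InnerProductSpace ℂ F] [CompleteSpace F]
  {G : Type w} [NormedAddCommGroup G] [InnerProductSpace ℂ G] [CompleteSpace G]

/-! ### The Schatten classes as operator ideals -/

theorem enorm_le_one_of_bessel {J : Type*} {e : J → E}
    (he : ∀ x, ∑' j, ‖⟪e j, x⟫_ℂ‖ₑ ^ 2 ≤ ‖x‖ₑ ^ 2) (j : J) : ‖e j‖ₑ ≤ 1 := by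
  have h1 : ‖⟪e j, e j⟫_ℂ‖ₑ ^ 2 ≤ ‖e j‖ₑ ^ 2 := (ENNReal.le_tsum j).trans (he (e j))
  have h2 : ‖⟪e j, e j⟫_ℂ‖ₑ ≤ ‖e j‖ₑ := (ENNReal.pow_le_pow_left_iff two_ne_zero).mp h1
  rw [← ofReal_norm, ← ofReal_norm, ENNReal.ofReal_le_ofReal_iff (norm_nonneg _)] at h2
  have h3 : ‖⟪e j, e j⟫_ℂ‖ = ‖e j‖ ^ 2 := by
    rw [inner_self_eq_norm_sq_to_K]; simp
  rw [h3] at h2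
  have h4 : ‖e j‖ ≤ 1 := by
    rcases (norm_nonneg (e j)).eq_or_lt with h0 | h0
    · rw [← h0]; exact zero_le_one
    · nlinarith
  rw [← ofReal_norm]
  exact ENNReal.ofReal_le_one.mpr h4

/-- The pairing bound `∑ |⟪f j, A (e j)⟫| ^ p ≤ Tr ((A* A) ^ (p / 2))` holds not only for
orthonormal families, but for all families satisfying Bessel's inequality. This class of families
is stable under contractions, which gives the ideal property. -/
theorem pairing_le_of_bessel {ι : Type*} {A : E →L[ℂ] F} {u : HilbertBasis ι ℂ E} {t : ι → ℝ≥0}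
    (h : IsEigenbasis (adjoint A ∘L A) u t) {p : ℝ} (hp : 1 ≤ p) {J : Type*} {e : J → E} {f : J → F}
    (he : ∀ x, ∑' j, ‖⟪e j, x⟫_ℂ‖ₑ ^ 2 ≤ ‖x‖ₑ ^ 2)
    (hf : ∀ y, ∑' j, ‖⟪f j, y⟫_ℂ‖ₑ ^ 2 ≤ ‖y‖ₑ ^ 2) :
    ∑' j, ‖⟪f j, A (e j)⟫_ℂ‖ₑ ^ p ≤ schattenTrace p A := by
  have hp0 : 0 < p := by linarith
  have he1 := enorm_le_one_of_bessel he
  have hf1 := enorm_le_one_of_bessel hf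
  have htwo : (2 : ℝ≥0∞)⁻¹ * (1 ^ 2 + 1 ^ 2) = 1 := by
    rw [one_pow, one_add_one_eq_two]
    exact ENNReal.inv_mul_cancel (by norm_num) (by norm_num)
  -- The weights `w j k` are doubly substochastic, so Jensen's inequality applies in both indices.
  set w : J → ι → ℝ≥0∞ := fun j k =>
    2⁻¹ * (‖⟪u k, e j⟫_ℂ‖ₑ ^ 2 + ‖⟪polarVec A u t k, f j⟫_ℂ‖ₑ ^ 2) with hw
  have hw1 : ∀ j, ∑' k, w j k ≤ 1 := fun j => by
    rw [ENNReal.tsum_mul_left, ENNReal.tsum_add, parseval u, ← htwo]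
    gcongr
    · exact he1 j
    · refine (bessel_polarVec h (f j)).trans ?_
      gcongr
      exact hf1 j
  have hnv : ∀ k, ‖polarVec A u t k‖ₑ ≤ 1 := enorm_le_one_of_bessel (bessel_polarVec h)
  have hnu : ∀ k, ‖u k‖ₑ ≤ 1 := enorm_le_one_of_bessel fun x => (parseval u x).le
  have hw2 : ∀ k, ∑' j, w j k ≤ 1 := fun k => by
    rw [ENNReal.tsum_mul_left, ENNReal.tsum_add, ← htwo]
    simp_rw [enorm_inner_symm (u k), enorm_inner_symm (polarVec A u t k)]
    gcongr
    · exact (he (u k)).trans (by gcongr; exact hnu k)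
    · exact (hf _).trans (by gcongr; exact hnv k)
  have hamgm : ∀ a b : ℝ≥0, (a : ℝ≥0∞) * b ≤ 2⁻¹ * ((a : ℝ≥0∞) ^ 2 + (b : ℝ≥0∞) ^ 2) := by
    intro a b
    have h1 : a * b ≤ 2⁻¹ * (a ^ 2 + b ^ 2) := by
      rw [← NNReal.coe_le_coe]
      push_cast
      nlinarith [sq_nonneg ((a : ℝ) - b)]
    have h2 : ((2⁻¹ : ℝ≥0) : ℝ≥0∞) = 2⁻¹ := by simp
    rw [← h2]
    exact_mod_cast h1
  -- Expand `e j` in the eigenbasis `u`; the singular values of `A` are the `√(t k)`.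
  have hterm : ∀ j, ‖⟪f j, A (e j)⟫_ℂ‖ₑ ≤ ∑' k, w j k * (NNReal.sqrt (t k) : ℝ≥0∞) := fun j => by
    have h1 := ((u.hasSum_repr (e j)).mapL A).mapL (innerSL ℂ (f j))
    have h2 : ⟪f j, A (e j)⟫_ℂ = ∑' k, ⟪f j, A (u.repr (e j) k • u k)⟫_ℂ := h1.tsum_eq.symm
    rw [h2]
    refine enorm_tsum_le_tsum_enorm.trans (ENNReal.tsum_le_tsum fun k => ?_)
    rw [map_smul, ← sqrt_smul_polarVec h k, inner_smul_right, inner_smul_right, enorm_mul,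
      enorm_mul, u.repr_apply_apply, enorm_inner_symm (f j)]
    have h3 : ‖((NNReal.sqrt (t k) : ℝ) : ℂ)‖ₑ = (NNReal.sqrt (t k) : ℝ≥0∞) := by
      rw [← ofReal_norm, Complex.norm_real, Real.norm_of_nonneg (NNReal.coe_nonneg _),
        ENNReal.ofReal_coe_nnreal]
    rw [h3, mul_left_comm, mul_comm]
    gcongr
    exact hamgm _ _
  calc _ ≤ ∑' j, (∑' k, w j k * (NNReal.sqrt (t k) : ℝ≥0∞)) ^ p := by
        refine ENNReal.tsum_le_tsum fun j => ?_
        gcongr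
        exact hterm j
    _ ≤ ∑' j, ∑' k, w j k * (NNReal.sqrt (t k) : ℝ≥0∞) ^ p :=
        ENNReal.tsum_le_tsum fun j => jensen hp _ _ (hw1 j)
    _ = ∑' k, (∑' j, w j k) * (NNReal.sqrt (t k) : ℝ≥0∞) ^ p := by
        rw [ENNReal.tsum_comm]
        exact tsum_congr fun k => ENNReal.tsum_mul_right
    _ ≤ ∑' k, 1 * (NNReal.sqrt (t k) : ℝ≥0∞) ^ p := by
        refine ENNReal.tsum_le_tsum fun k => ?_
        gcongr
        exact hw2 k
    _ = _ := by
        rw [schattenTrace_eq hp0 A h]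
        refine tsum_congr fun k => ?_
        rw [one_mul, ← ENNReal.coe_rpow_of_nonneg _ hp0.le, NNReal.sqrt_eq_rpow, ← NNReal.rpow_mul]
        congr 2
        ring

/-- For a compact operator, the pairings against the singular vectors compute the Schatten trace;
hence a bound on all pairings is a bound on the trace. -/
theorem schattenTrace_le_of_pairing_le {p : ℝ} (hp0 : 0 < p) {A : E →L[ℂ] F}
    (hA : IsCompactOperator A) {C : ℝ≥0∞}
    (hC : ∀ (J : Type u) (e : J → E) (f : J → F), Orthonormal ℂ e → Orthonormal ℂ f →
      ∑' j, ‖⟪f j, A (e j)⟫_ℂ‖ₑ ^ p ≤ C) : schattenTrace p A ≤ C := by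
  obtain ⟨ι, u, t, h⟩ := exists_eigenbasis (adjoint A ∘L A) (adjoint_comp_nonneg _)
    (hA.clm_comp (adjoint A))
  have hu : Orthonormal ℂ fun k : {k // t k ≠ 0} => u k :=
    u.orthonormal.comp _ Subtype.val_injective
  refine le_trans (le_of_eq ?_) (hC _ _ _ hu (orthonormal_polarVec h))
  have h2 : Function.support (fun k => ‖⟪polarVec A u t k, A (u k)⟫_ℂ‖ₑ ^ p) ⊆ {k | t k ≠ 0} := by
    intro k hk hk0
    simp [polarVec, hk0, hp0] at hk
  rw [schattenTrace_eq hp0 _ h]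
  refine Eq.trans ?_ (tsum_subtype_eq_of_support_subset h2).symm
  refine tsum_congr fun k => ?_
  rw [inner_polarVec h, ← ofReal_norm, Complex.norm_real,
    Real.norm_of_nonneg (NNReal.coe_nonneg _), ENNReal.ofReal_coe_nnreal,
    ← ENNReal.coe_rpow_of_nonneg _ hp0.le, NNReal.sqrt_eq_rpow, ← NNReal.rpow_mul]
  congr 2
  ring

theorem bessel_map_of_norm_le_one {J : Type*} {e : J → E} (he : Orthonormal ℂ e) {T : E →L[ℂ] F}
    (hT : ‖T‖ ≤ 1) (y : F) : ∑' j, ‖⟪T (e j), y⟫_ℂ‖ₑ ^ 2 ≤ ‖y‖ₑ ^ 2 := by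
  simp_rw [← adjoint_inner_right]
  refine (bessel he _).trans ?_
  gcongr
  rw [← ofReal_norm, ← ofReal_norm]
  refine ENNReal.ofReal_le_ofReal ?_
  have := (adjoint T).le_of_opNorm_le (c := 1) (by rwa [LinearIsometryEquiv.norm_map]) y
  rwa [one_mul] at this

theorem schattenTrace_comp_comp_le_of_norm_le_one {D : Type*} [NormedAddCommGroup D]
    [InnerProductSpace ℂ D] [CompleteSpace D] {p : ℝ} (hp : 1 ≤ p) {A : E →L[ℂ] F}
    (hA : MemSchatten p A) {B : F →L[ℂ] G} {C : D →L[ℂ] E} (hB : ‖B‖ ≤ 1) (hC : ‖C‖ ≤ 1) :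
    schattenTrace p (B ∘L A ∘L C) ≤ schattenTrace p A := by
  have hp0 : 0 < p := by linarith
  obtain ⟨ι, u, t, h⟩ := exists_eigenbasis_of_mem hp0 hA
  refine schattenTrace_le_of_pairing_le hp0
    (((isCompactOperator_of_mem hp0 hA).comp_clm C).clm_comp B) fun J e f he hf => ?_
  have hB' : ‖adjoint B‖ ≤ 1 := by rwa [LinearIsometryEquiv.norm_map]
  refine le_trans (le_of_eq ?_)
    (pairing_le_of_bessel h hp (bessel_map_of_norm_le_one he hC) (bessel_map_of_norm_le_one hf hB'))
  simp [adjoint_inner_left]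

/-- The Schatten classes are two-sided operator ideals; this is the contractive case, rescaled. -/
theorem schattenTrace_comp_comp_le {D : Type*} [NormedAddCommGroup D]
    [InnerProductSpace ℂ D] [CompleteSpace D] {p : ℝ} (hp : 1 ≤ p) {A : E →L[ℂ] F}
    (hA : MemSchatten p A) (B : F →L[ℂ] G) (C : D →L[ℂ] E) :
    schattenTrace p (B ∘L A ∘L C) ≤ (‖B‖ₑ * ‖C‖ₑ) ^ p * schattenTrace p A := by
  have hp0 : 0 < p := by linarith
  rcases eq_or_ne B 0 with rfl | hB
  · simp [schattenTrace_zero hp0]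
  rcases eq_or_ne C 0 with rfl | hC
  · simp [schattenTrace_zero hp0]
  have hB0 : ‖B‖ ≠ 0 := norm_ne_zero_iff.mpr hB
  have hC0 : ‖C‖ ≠ 0 := norm_ne_zero_iff.mpr hC
  set B' : F →L[ℂ] G := ((‖B‖ : ℂ))⁻¹ • B with hB'
  set C' : D →L[ℂ] E := ((‖C‖ : ℂ))⁻¹ • C with hC'
  have hle := schattenTrace_comp_comp_le_of_norm_le_one hp hA (B := B') (C := C')
    (by rw [hB', norm_smul]; simp [hB0]) (by rw [hC', norm_smul]; simp [hC0])
  have heq : B ∘L A ∘L C = ((‖B‖ * ‖C‖ : ℝ) : ℂ) • (B' ∘L A ∘L C') := by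
    ext x
    have hB1 : (‖B‖ : ℂ) ≠ 0 := by exact_mod_cast hB0
    have hC1 : (‖C‖ : ℂ) ≠ 0 := by exact_mod_cast hC0
    simp only [hB', hC', comp_apply, smul_apply, map_smul, smul_smul, Complex.ofReal_mul]
    field_simp
    simp
  rw [heq, schattenTrace_smul hp0 _ (hle.trans_lt hA)]
  have hn : ‖((‖B‖ * ‖C‖ : ℝ) : ℂ)‖ₑ = ‖B‖ₑ * ‖C‖ₑ := by
    rw [Complex.ofReal_mul, enorm_mul, ← ofReal_norm, ← ofReal_norm, Complex.norm_real,
      Complex.norm_real, norm_norm, norm_norm, ofReal_norm, ofReal_norm]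
  rw [hn]
  gcongr

theorem MemSchatten.comp_comp {D : Type*} [NormedAddCommGroup D]
    [InnerProductSpace ℂ D] [CompleteSpace D] {p : ℝ} (hp : 1 ≤ p) {A : E →L[ℂ] F}
    (hA : MemSchatten p A) (B : F →L[ℂ] G) (C : D →L[ℂ] E) : MemSchatten p (B ∘L A ∘L C) :=
  (schattenTrace_comp_comp_le hp hA B C).trans_lt <| ENNReal.mul_lt_top
    (ENNReal.rpow_lt_top_of_nonneg (by linarith)
      (ENNReal.mul_ne_top enorm_ne_top enorm_ne_top)) hA

theorem MemSchatten.clm_comp {p : ℝ} (hp : 1 ≤ p) {A : E →L[ℂ] F}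
    (hA : MemSchatten p A) (B : F →L[ℂ] G) : MemSchatten p (B ∘L A) :=
  hA.comp_comp hp B (.id ℂ E)

theorem MemSchatten.comp_clm {D : Type*} [NormedAddCommGroup D]
    [InnerProductSpace ℂ D] [CompleteSpace D] {p : ℝ} (hp : 1 ≤ p) {A : E →L[ℂ] F}
    (hA : MemSchatten p A) (C : D →L[ℂ] E) : MemSchatten p (A ∘L C) :=
  hA.comp_comp hp (.id ℂ F) C

theorem memSchatten_of_finiteDimensional [FiniteDimensional ℂ E] {p : ℝ} (hp : 0 < p)
    (A : E →L[ℂ] F) : MemSchatten p A := by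
  obtain ⟨ι, u, t, h⟩ := exists_eigenbasis (adjoint A ∘L A) (adjoint_comp_nonneg _)
    (isCompactOperator_of_locallyCompactSpace_dom _)
  have : Finite ι := u.orthonormal.linearIndependent.finite
  have := Fintype.ofFinite ι
  rw [MemSchatten, schattenTrace_eq hp A h, tsum_fintype]
  exact ENNReal.sum_lt_top.mpr fun _ _ => ENNReal.coe_lt_top

theorem memSchatten_of_finiteDimensional_range {p : ℝ} (hp : 1 ≤ p) (A : E →L[ℂ] F)
    [FiniteDimensional ℂ A.range] : MemSchatten p A :=
  (memSchatten_of_finiteDimensional (by linarith) A.range.subtypeL).comp_clm hp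
    (A.codRestrict A.range fun x => ⟨x, rfl⟩)

/-! ### Completeness of the Schatten classes -/

theorem enorm_le_schattenTrace_rpow {p : ℝ} (hp : 0 < p) {A : E →L[ℂ] F} (hA : MemSchatten p A) :
    ‖A‖ₑ ≤ schattenTrace p A ^ (1 / p) := by
  obtain ⟨ι, u, t, h⟩ := exists_eigenbasis_of_mem hp hA
  refine ContinuousLinearMap.opENorm_le_bound _ fun x => ?_
  rw [← ENNReal.pow_le_pow_left_iff two_ne_zero, enorm_apply_sq A h x, mul_pow, ← parseval u x,
    ← ENNReal.tsum_mul_left]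
  refine ENNReal.tsum_le_tsum fun k => ?_
  gcongr
  have h1 : ((t k ^ (p / 2) : ℝ≥0) : ℝ≥0∞) ≤ schattenTrace p A := by
    rw [schattenTrace_eq hp A h]
    exact ENNReal.le_tsum k
  calc (t k : ℝ≥0∞) = (((t k ^ (p / 2) : ℝ≥0) : ℝ≥0∞) ^ (1 / p)) ^ 2 := by
        rw [ENNReal.coe_rpow_of_nonneg _ (by positivity), ← ENNReal.rpow_natCast,
          ← ENNReal.rpow_mul, ← ENNReal.rpow_mul]
        norm_num
        rw [show p / 2 * (p⁻¹ * 2) = 1 by field_simp, ENNReal.rpow_one]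
    _ ≤ _ := by gcongr

section normed

variable {p : ℝ} [hp : Fact (1 ≤ p)]

theorem SchattenClass.ext {A B : SchattenClass E F p} (h : A.toCLM = B.toCLM) : A = B :=
  Subtype.ext h

theorem SchattenClass.enorm_def (A : SchattenClass E F p) :
    ‖A‖ₑ = schattenTrace p A.toCLM ^ (1 / p) := by
  have hp0 : 0 < p := by linarith [hp.out]
  rw [← ofReal_norm, SchattenClass.norm_def, schattenNorm, ENNReal.toReal_rpow]
  exact ENNReal.ofReal_toReal (ENNReal.rpow_ne_top_of_nonneg (by positivity) A.2.ne)

theorem SchattenClass.enorm_rpow (A : SchattenClass E F p) :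
    ‖A‖ₑ ^ p = schattenTrace p A.toCLM := by
  have hp0 : 0 < p := by linarith [hp.out]
  rw [A.enorm_def, ← ENNReal.rpow_mul, one_div, inv_mul_cancel₀ hp0.ne', ENNReal.rpow_one]

theorem SchattenClass.norm_toCLM_le (A : SchattenClass E F p) : ‖A.toCLM‖ ≤ ‖A‖ := by
  have h := enorm_le_schattenTrace_rpow (by linarith [hp.out]) A.2
  change ‖A.toCLM‖ₑ ≤ schattenTrace p A.toCLM ^ (1 / p) at h
  rw [← A.enorm_def] at h
  rwa [← ofReal_norm, ← ofReal_norm, ENNReal.ofReal_le_ofReal_iff (norm_nonneg _)] at h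

variable (E F p) in
/-- The contractive inclusion of `L_p(E, F)` into the bounded operators with the operator norm. -/
def SchattenClass.toCLML : SchattenClass E F p →L[ℂ] E →L[ℂ] F :=
  LinearMap.mkContinuous
    { toFun := SchattenClass.toCLM
      map_add' := fun _ _ => rfl
      map_smul' := fun _ _ => rfl } 1 fun A => by
    rw [one_mul]
    exact A.norm_toCLM_le

theorem SchattenClass.norm_le_of_schattenTrace_le {D : Type*} [NormedAddCommGroup D]
    [InnerProductSpace ℂ D] [CompleteSpace D] {A : SchattenClass E F p} {B : SchattenClass D G p}
    {C : ℝ} (hC : 0 ≤ C)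
    (h : schattenTrace p B.toCLM ≤ ENNReal.ofReal C ^ p * schattenTrace p A.toCLM) :
    ‖B‖ ≤ C * ‖A‖ := by
  have hp0 : 0 < p := by linarith [hp.out]
  rw [← A.enorm_rpow, ← B.enorm_rpow, ← ENNReal.mul_rpow_of_nonneg _ _ hp0.le,
    ENNReal.rpow_le_rpow_iff hp0, ← ofReal_norm, ← ofReal_norm, ← ENNReal.ofReal_mul hC,
    ENNReal.ofReal_le_ofReal_iff (by positivity)] at h
  exact h

variable (p) in
/-- Composition `(C, A) ↦ A ∘ C` with a bounded operator `C` on the right, as a bounded bilinear map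
with values in the Schatten class. -/
def SchattenClass.compRight (D : Type*) (E : Type*) (F : Type*) [NormedAddCommGroup D]
    [InnerProductSpace ℂ D] [CompleteSpace D] [NormedAddCommGroup E]
    [InnerProductSpace ℂ E] [CompleteSpace E] [NormedAddCommGroup F]
    [InnerProductSpace ℂ F] [CompleteSpace F] :
    (D →L[ℂ] E) →L[ℂ] SchattenClass E F p →L[ℂ] SchattenClass D F p :=
  LinearMap.mkContinuous₂
    (LinearMap.mk₂ ℂ (fun C A => (⟨A.toCLM ∘L C, MemSchatten.comp_clm hp.out A.2 C⟩ :
        SchattenClass D F p))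
      (fun _ _ _ => SchattenClass.ext (comp_add _ _ _))
      (fun _ _ _ => SchattenClass.ext (comp_smul _ _ _))
      (fun _ _ _ => SchattenClass.ext (add_comp _ _ _))
      (fun _ _ _ => SchattenClass.ext (smul_comp _ _ _))) 1 fun C A => by
    rw [one_mul]
    refine SchattenClass.norm_le_of_schattenTrace_le (norm_nonneg C) ?_
    refine (schattenTrace_comp_comp_le hp.out A.2 (.id ℂ F) C).trans ?_
    change _ ≤ _ * schattenTrace p A.1
    rw [ofReal_norm]
    have hp0 : 0 ≤ p := by linarith [hp.out]
    gcongr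
    refine mul_le_of_le_one_left zero_le ?_
    rw [← ofReal_norm]
    exact ENNReal.ofReal_le_one.mpr norm_id_le

variable (p) (E) in
/-- Composition `A ↦ B ∘ A` with a bounded operator `B` on the left, as a bounded linear map between
Schatten classes. -/
def SchattenClass.compLeft (B : F →L[ℂ] G) : SchattenClass E F p →L[ℂ] SchattenClass E G p :=
  LinearMap.mkContinuous
    { toFun := fun A => (⟨B ∘L A.toCLM, MemSchatten.clm_comp hp.out A.2 B⟩ : SchattenClass E G p)
      map_add' := fun _ _ => SchattenClass.ext (comp_add _ _ _)
      map_smul' := fun _ _ => SchattenClass.ext (comp_smul _ _ _) } ‖B‖ fun A => by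
    refine SchattenClass.norm_le_of_schattenTrace_le (norm_nonneg B) ?_
    refine (schattenTrace_comp_comp_le hp.out A.2 B (.id ℂ E)).trans ?_
    change _ ≤ _ * schattenTrace p A.1
    rw [ofReal_norm]
    have hp0 : 0 ≤ p := by linarith [hp.out]
    gcongr
    refine mul_le_of_le_one_right zero_le ?_
    rw [← ofReal_norm]
    exact ENNReal.ofReal_le_one.mpr norm_id_le

/-- Fatou's lemma for Schatten traces: a limit in operator norm of operators in a ball of `L_p` lies
in this ball. -/
theorem schattenTrace_le_of_tendsto {A : ℕ → E →L[ℂ] F} {B : E →L[ℂ] F}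
    (hA : ∀ n, MemSchatten p (A n)) (h : Filter.Tendsto A Filter.atTop (nhds B)) {C : ℝ≥0∞}
    (hC : ∀ᶠ n in Filter.atTop, schattenTrace p (A n) ≤ C) : schattenTrace p B ≤ C := by
  have hp0 : 0 < p := by linarith [hp.out]
  refine schattenTrace_le_of_pairing_le hp0 (isCompactOperator_of_tendsto h
    (.of_forall fun n => isCompactOperator_of_mem hp0 (hA n))) fun J e f he hf => ?_
  rw [ENNReal.tsum_eq_iSup_sum]
  refine iSup_le fun s => ?_
  have hlim : Filter.Tendsto (fun n => ∑ j ∈ s, ‖⟪f j, A n (e j)⟫_ℂ‖ₑ ^ p) Filter.atTop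
      (nhds (∑ j ∈ s, ‖⟪f j, B (e j)⟫_ℂ‖ₑ ^ p)) := by
    refine tendsto_finsetSum _ fun j _ => ?_
    have h1 : Filter.Tendsto (fun n => ⟪f j, A n (e j)⟫_ℂ) Filter.atTop (nhds ⟪f j, B (e j)⟫_ℂ) :=
      ((innerSL ℂ (f j)).continuous.tendsto _).comp
        (((ContinuousLinearMap.apply ℂ F (e j)).continuous.tendsto B).comp h)
    exact ((ENNReal.continuous_rpow_const (y := p)).tendsto _).comp
      ((continuous_enorm.tendsto _).comp h1)
  refine le_of_tendsto hlim (hC.mono fun n hn => ?_)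
  obtain ⟨ι, u, t, ht⟩ := exists_eigenbasis_of_mem hp0 (hA n)
  exact ((ENNReal.sum_le_tsum s).trans (pairing_le ht hp.out he hf)).trans hn

instance : CompleteSpace (SchattenClass E F p) := by
  have hp0 : 0 < p := by linarith [hp.out]
  refine Metric.complete_of_cauchySeq_tendsto fun A hA => ?_
  obtain ⟨B, hB⟩ := cauchySeq_tendsto_of_complete
    ((SchattenClass.toCLML E F p).uniformContinuous.comp_cauchySeq hA)
  have hmem : ∀ A : SchattenClass E F p, MemSchatten p A.toCLM := fun A => A.2
  have key : ∀ ε : ℝ, 0 < ε → ∃ N, ∀ n ≥ N,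
      schattenTrace p ((A n).toCLM - B) ≤ ENNReal.ofReal ε ^ p := by
    intro ε hε
    obtain ⟨N, hN⟩ := Metric.cauchySeq_iff.mp hA ε hε
    refine ⟨N, fun n hn => schattenTrace_le_of_tendsto
      (A := fun m => (A n - A m).toCLM) (fun m => hmem _) ?_ ?_⟩
    · exact tendsto_const_nhds.sub hB
    · filter_upwards [Filter.eventually_ge_atTop N] with m hm
      rw [← SchattenClass.enorm_rpow]
      gcongr
      rw [← ofReal_norm, ← dist_eq_norm]
      exact ENNReal.ofReal_le_ofReal (hN n hn m hm).le
  have hBmem : MemSchatten p B := by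
    obtain ⟨N, hN⟩ := key 1 one_pos
    have h1 : MemSchatten p ((A N).toCLM - B) := (hN N le_rfl).trans_lt
      (ENNReal.rpow_lt_top_of_nonneg hp0.le ENNReal.ofReal_ne_top)
    have h2 := MemSchatten.add hp.out (hmem (A N)) (MemSchatten.smul hp.out (-1) h1)
    simpa using h2
  let B' : SchattenClass E F p := ⟨B, hBmem⟩
  refine ⟨B', Metric.tendsto_atTop.mpr fun ε hε => ?_⟩
  obtain ⟨N, hN⟩ := key (ε / 2) (by positivity)
  refine ⟨N, fun n hn => lt_of_le_of_lt ?_ (half_lt_self hε)⟩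
  have h1 := hN n hn
  change schattenTrace p (A n - B').toCLM ≤ _ at h1
  rw [← SchattenClass.enorm_rpow, ENNReal.rpow_le_rpow_iff hp0, ← ofReal_norm,
    ENNReal.ofReal_le_ofReal_iff (by positivity), ← dist_eq_norm] at h1
  exact h1

end normed

end Schatten

/-! ### Fredholm operators and compact perturbations -/

namespace ContinuousLinearMap

open scoped LinearMap.FiniteRangeSetoid

/-- The approximation is `P ∘ K`, for the orthogonal projection `P` onto the span of a finite net of
the image of the unit ball. -/
theorem exists_finiteRange_norm_sub_lt {E F : Type*} [NormedAddCommGroup E] [NormedSpace ℂ E]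
    [NormedAddCommGroup F] [InnerProductSpace ℂ F]
    {K : E →L[ℂ] F} (hK : IsCompactOperator K) {ε : ℝ} (hε : 0 < ε) :
    ∃ R : E →L[ℂ] F, R.HasFiniteRange ∧ ‖K - R‖ < ε := by
  obtain ⟨S, hS, hKS⟩ := IsCompactOperator.image_closedBall_subset_compact
    (f := (K : E →ₗ[ℂ] F)) hK 1
  obtain ⟨t, ht, hSt⟩ := Metric.totallyBounded_iff.mp hS.totallyBounded (ε / 2) (by positivity)
  have : FiniteDimensional ℂ (Submodule.span ℂ t) := FiniteDimensional.span_of_finite ℂ ht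
  refine ⟨(Submodule.span ℂ t).starProjection ∘L K, ?_, lt_of_le_of_lt ?_ (half_lt_self hε)⟩
  · have h1 : ((Submodule.span ℂ t).subtype ∘ₗ
        ((Submodule.span ℂ t).orthogonalProjectionOnto ∘L K : E →L[ℂ] _).toLinearMap
          ).HasFiniteRange :=
      LinearMap.HasFiniteRange.comp_left LinearMap.HasFiniteRange.of_isNoetherian_rng _
    exact h1
  · refine ContinuousLinearMap.opNorm_le_of_unit_norm (𝕜 := ℂ) (by positivity) fun x hx => ?_
    obtain ⟨y, hy, hyx⟩ := Set.mem_iUnion₂.mp (hSt (hKS ⟨x, by simp [hx], rfl⟩))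
    set P := (Submodule.span ℂ t).starProjection with hP
    have h1 : P y = y :=
      Submodule.starProjection_eq_self_iff.mpr (Submodule.subset_span hy)
    have h2 : (K - P ∘L K) x = (Submodule.span ℂ t)ᗮ.starProjection (K x - y) := by
      rw [Submodule.starProjection_orthogonal']
      simp [← hP, h1]
    rw [h2]
    refine ((Submodule.span ℂ t)ᗮ.norm_starProjection_apply_le _).trans ?_
    rw [← dist_eq_norm]
    exact (Metric.mem_ball.mp hyx).le

theorem _root_.LinearMap.IsLeftQuasiInverse.isQuasiInverse {K V W : Type*} [CommRing K]
    [AddCommGroup V] [Module K V] [AddCommGroup W] [Module K W] {u : V →ₗ[K] W} {l r : W →ₗ[K] V}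
    (hl : l.IsLeftQuasiInverse u) (hr : r.IsRightQuasiInverse u) : r.IsQuasiInverse u := by
  refine ⟨?_, hr⟩
  calc r ∘ₗ u = .id ∘ₗ (r ∘ₗ u) := rfl
    _ ≈ (l ∘ₗ u) ∘ₗ (r ∘ₗ u) := by grw [hl.equiv]
    _ = l ∘ₗ (u ∘ₗ r) ∘ₗ u := rfl
    _ ≈ l ∘ₗ .id ∘ₗ u := by grw [hr.equiv]
    _ ≈ .id := hl.equiv

theorem IsFredholm.comp_equiv {E F G : Type*} [NormedAddCommGroup E] [NormedSpace ℂ E]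
    [NormedAddCommGroup F] [NormedSpace ℂ F] [NormedAddCommGroup G] [NormedSpace ℂ G]
    {u : E →L[ℂ] F} (hu : u.IsFredholm) (e : G ≃L[ℂ] E) : (u ∘L (e : G →L[ℂ] E)).IsFredholm := by
  obtain ⟨v, hv⟩ := hu.exists_isQuasiInverse
  have he : ((e.symm : E →L[ℂ] G) : E →ₗ[ℂ] G).IsQuasiInverse ((e : G →L[ℂ] E) : G →ₗ[ℂ] E) :=
    e.toLinearEquiv.isQuasiInverse
  exact .of_isQuasiInverse (v := (e.symm : E →L[ℂ] G) ∘L v) (he.comp hv)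

theorem exists_equiv_eq_one_add {X : Type*} [NormedAddCommGroup X] [NormedSpace ℂ X]
    [CompleteSpace X] {T : X →L[ℂ] X} (hT : ‖T‖ < 1) :
    ∃ e : X ≃L[ℂ] X, ∀ x, e x = x + T x := by
  refine ⟨ContinuousLinearEquiv.unitsEquiv ℂ X (Units.oneSub (-T) (by rwa [norm_neg])),
    fun x => ?_⟩
  simp

/-- Modulo operators of finite rank the perturbation is small, so that a quasi-inverse is corrected
by a Neumann series. -/
theorem IsFredholm.add_isCompactOperator {E F : Type*} [NormedAddCommGroup E] [NormedSpace ℂ E]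
    [CompleteSpace E] [NormedAddCommGroup F] [InnerProductSpace ℂ F] [CompleteSpace F]
    {u K : E →L[ℂ] F} (hu : u.IsFredholm) (hK : IsCompactOperator K) : (u + K).IsFredholm := by
  obtain ⟨v, hvu, huv⟩ := hu.exists_isQuasiInverse
  obtain ⟨R, hR, hRK⟩ := exists_finiteRange_norm_sub_lt hK (ε := (‖v‖ + 1)⁻¹) (by positivity)
  set D := K - R with hD
  have hsmall : ‖v‖ * ‖D‖ < 1 := by
    have h1 : ‖v‖ * ‖D‖ ≤ ‖v‖ * (‖v‖ + 1)⁻¹ := by gcongr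
    refine h1.trans_lt ?_
    rw [← div_eq_mul_inv, div_lt_one (by positivity)]
    linarith
  have hDv : ‖D ∘L v‖ < 1 := (opNorm_comp_le _ _).trans_lt (by rwa [mul_comm])
  have hvD : ‖v ∘L D‖ < 1 := (opNorm_comp_le _ _).trans_lt hsmall
  obtain ⟨e₁, he₁⟩ := exists_equiv_eq_one_add hDv
  obtain ⟨e₂, he₂⟩ := exists_equiv_eq_one_add hvD
  -- `v (1 + D v)⁻¹` and `(1 + v D)⁻¹ v` are right and left quasi-inverses of `u + D + R`.
  have hr : ((v ∘L (e₁.symm : F →L[ℂ] F) : F →L[ℂ] E) : F →ₗ[ℂ] E).IsRightQuasiInverse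
      ((u + K : E →L[ℂ] F) : E →ₗ[ℂ] F) := by
    have h1 := (LinearMap.FiniteRangeSetoid.equiv_iff_hasFiniteRange.mp huv).comp_right
      (e₁.symm : F →L[ℂ] F).toLinearMap
    refine LinearMap.FiniteRangeSetoid.equiv_iff_hasFiniteRange.mpr ?_
    convert! h1.add (hR.comp_right (v ∘L (e₁.symm : F →L[ℂ] F)).toLinearMap) using 1
    ext y
    obtain ⟨z, rfl⟩ := e₁.surjective y
    have h2 : e₁ z = z + (K (v z) - R (v z)) := he₁ z
    simp only [LinearMap.sub_apply, LinearMap.add_apply, LinearMap.comp_apply, coe_coe, add_apply,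
      comp_apply, ContinuousLinearEquiv.coe_coe, ContinuousLinearEquiv.symm_apply_apply,
      LinearMap.id_apply]
    rw [h2]
    abel
  have hl : (((e₂.symm : E →L[ℂ] E) ∘L v : F →L[ℂ] E) : F →ₗ[ℂ] E).IsLeftQuasiInverse
      ((u + K : E →L[ℂ] F) : E →ₗ[ℂ] F) := by
    have h1 := (LinearMap.FiniteRangeSetoid.equiv_iff_hasFiniteRange.mp hvu).comp_left
      (e₂.symm : E →L[ℂ] E).toLinearMap
    refine LinearMap.FiniteRangeSetoid.equiv_iff_hasFiniteRange.mpr ?_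
    convert! h1.add (hR.comp_left ((e₂.symm : E →L[ℂ] E) ∘L v).toLinearMap) using 1
    ext x
    have h2 : e₂ x = x + v (K x - R x) := he₂ x
    apply e₂.injective
    simp only [LinearMap.sub_apply, LinearMap.add_apply, LinearMap.comp_apply, coe_coe, add_apply,
      comp_apply, ContinuousLinearEquiv.coe_coe, ContinuousLinearEquiv.apply_symm_apply,
      LinearMap.id_apply, map_add, map_sub, h2]
    abel
  exact .of_isQuasiInverse (hl.isQuasiInverse hr)

end ContinuousLinearMap

namespace RestrictedGrassmannian

open Schatten

/-! ### Graphs of operators `V → Vᗮ` -/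

section graph

variable {H : Type*} [NormedAddCommGroup H] [InnerProductSpace ℂ H] [CompleteSpace H]

theorem proj_add_proj_orthogonal (V W : ClosedSubmodule ℂ H) (x : W.toSubmodule) :
    (proj V W x : H) + (proj Vᗮ W x : H) = x :=
  V.toSubmodule.starProjection_add_starProjection_orthogonal (x : H)

theorem proj_comp_proj_add (U K V : ClosedSubmodule ℂ H) :
    proj U K ∘L proj K V + proj U Kᗮ ∘L proj Kᗮ V = proj U V := by
  ext x
  change ((U.toSubmodule.orthogonalProjectionOnto (proj K V x : H) +
    U.toSubmodule.orthogonalProjectionOnto (proj Kᗮ V x : H) : U.toSubmodule) : H) = _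
  rw [← map_add, proj_add_proj_orthogonal]
  rfl

theorem proj_orthogonal_self (V : ClosedSubmodule ℂ H) : proj Vᗮ V = 0 := by
  refine ContinuousLinearMap.ext fun x => ?_
  have h : V.toSubmoduleᗮ.orthogonalProjectionOnto (x : H) = 0 :=
    Submodule.orthogonalProjectionOnto_orthogonal_apply_eq_zero x.2
  exact h

theorem proj_self (V : ClosedSubmodule ℂ H) : proj V V = .id ℂ _ := by
  refine ContinuousLinearMap.ext fun x => ?_
  exact Submodule.orthogonalProjectionOnto_mem_subspace_eq_self x

theorem proj_self_orthogonal (V : ClosedSubmodule ℂ H) : proj V Vᗮ = 0 := by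
  refine ContinuousLinearMap.ext fun x => ?_
  have h : V.toSubmodule.orthogonalProjectionOnto (x : H) = 0 :=
    Submodule.orthogonalProjectionOnto_apply_of_mem_orthogonal x.2
  exact h

theorem adjoint_proj (V W : ClosedSubmodule ℂ H) :
    ContinuousLinearMap.adjoint (proj V W) = proj W V := by
  rw [proj, ContinuousLinearMap.adjoint_comp, Submodule.adjoint_subtypeL,
    Submodule.adjoint_orthogonalProjectionOnto]
  rfl

theorem isInvertible_proj_symm {V W : ClosedSubmodule ℂ H} (h : (proj V W).IsInvertible) :
    (proj W V).IsInvertible := by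
  refine .of_inverse (g := ContinuousLinearMap.adjoint (proj V W).inverse) ?_ ?_
  · rw [← adjoint_proj V W, ← ContinuousLinearMap.adjoint_comp, h.inverse_comp_self,
      ContinuousLinearMap.adjoint_id]
  · rw [← adjoint_proj V W, ← ContinuousLinearMap.adjoint_comp, h.self_comp_inverse,
      ContinuousLinearMap.adjoint_id]

variable {V : ClosedSubmodule ℂ H}

/-- The graph `{x + A x : x ∈ V}` of an operator `A : V → Vᗮ`, given as the closed subspace of all
`y` with `pr_Vᗮ y = A (pr_V y)`. -/
def graph (A : V.toSubmodule →L[ℂ] (Vᗮ).toSubmodule) : ClosedSubmodule ℂ H where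
  toSubmodule := ((Vᗮ).toSubmodule.orthogonalProjectionOnto -
    A ∘L V.toSubmodule.orthogonalProjectionOnto).ker
  isClosed' := ContinuousLinearMap.isClosed_ker _

theorem mem_graph_iff {A : V.toSubmodule →L[ℂ] (Vᗮ).toSubmodule} {y : H} :
    y ∈ (graph A).toSubmodule ↔ (Vᗮ).toSubmodule.orthogonalProjectionOnto y =
      A (V.toSubmodule.orthogonalProjectionOnto y) :=
  sub_eq_zero

variable (A : V.toSubmodule →L[ℂ] (Vᗮ).toSubmodule)

theorem add_apply_mem_graph (x : V.toSubmodule) : (x : H) + (A x : H) ∈ (graph A).toSubmodule := by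
  have h1 : (Vᗮ).toSubmodule.orthogonalProjectionOnto (x : H) = 0 :=
    congr($(proj_orthogonal_self V) x)
  have h2 : V.toSubmodule.orthogonalProjectionOnto (A x : H) = 0 :=
    congr($(proj_self_orthogonal V) (A x))
  have h3 : V.toSubmodule.orthogonalProjectionOnto (x : H) = x := congr($(proj_self V) x)
  have h4 : (Vᗮ).toSubmodule.orthogonalProjectionOnto (A x : H) = A x :=
    congr($(proj_self Vᗮ) (A x))
  rw [mem_graph_iff, map_add, map_add, h1, h2, h3, h4, zero_add, add_zero]

/-- The isomorphism `x ↦ x + A x` of `V` onto the graph of `A`; its inverse is the restriction of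
`pr_V`. -/
def graphEquiv : V.toSubmodule ≃L[ℂ] (graph A).toSubmodule :=
  ContinuousLinearEquiv.equivOfInverse
    ((V.toSubmodule.subtypeL + (Vᗮ).toSubmodule.subtypeL ∘L A).codRestrict (graph A).toSubmodule
      (add_apply_mem_graph A))
    (proj V (graph A))
    (fun x => by
      have h2 : V.toSubmodule.orthogonalProjectionOnto (A x : H) = 0 :=
        congr($(proj_self_orthogonal V) (A x))
      have h3 : V.toSubmodule.orthogonalProjectionOnto (x : H) = x := congr($(proj_self V) x)
      change V.toSubmodule.orthogonalProjectionOnto ((x : H) + (A x : H)) = x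
      rw [map_add, h2, h3, add_zero])
    (fun y => Subtype.ext <| by
      change (proj V (graph A) y : H) + (A (proj V (graph A) y) : H) = y
      have h := mem_graph_iff.mp y.2
      change proj Vᗮ (graph A) y = A (proj V (graph A) y) at h
      rw [← h, proj_add_proj_orthogonal])

theorem isInvertible_proj_graph : (proj V (graph A)).IsInvertible :=
  ⟨(graphEquiv A).symm, rfl⟩

theorem coe_graph : ((graph A).toSubmodule : Set H) =
    Set.range fun x : V.toSubmodule => (x : H) + (A x : H) := by
  ext y
  refine ⟨fun hy => ?_, ?_⟩
  · obtain ⟨x, hx⟩ := (graphEquiv A).surjective ⟨y, hy⟩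
    exact ⟨x, congrArg Subtype.val hx⟩
  · rintro ⟨x, rfl⟩
    exact add_apply_mem_graph A x

theorem proj_comp_graphEquiv (U : ClosedSubmodule ℂ H) :
    proj U (graph A) ∘L (graphEquiv A : V.toSubmodule →L[ℂ] (graph A).toSubmodule) =
      proj U V + proj U Vᗮ ∘L A := by
  ext x
  change ((U.toSubmodule.orthogonalProjectionOnto ((x : H) + (A x : H)) : U.toSubmodule) : H) = _
  rw [map_add]
  rfl

theorem proj_graph (U : ClosedSubmodule ℂ H) :
    proj U (graph A) = (proj U V + proj U Vᗮ ∘L A) ∘L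
      ((graphEquiv A).symm : (graph A).toSubmodule →L[ℂ] V.toSubmodule) := by
  rw [← proj_comp_graphEquiv]
  ext x
  simp [-ClosedSubmodule.toSubmodule_orthogonal_eq]

theorem proj_comp_inverse_graph (U : ClosedSubmodule ℂ H) :
    proj Uᗮ (graph A) ∘L (proj U (graph A)).inverse =
      (proj Uᗮ V + proj Uᗮ Vᗮ ∘L A) ∘L (proj U V + proj U Vᗮ ∘L A).inverse := by
  rw [← proj_comp_graphEquiv, ← proj_comp_graphEquiv, ContinuousLinearMap.inverse_comp_equiv]
  ext x
  simp [-ClosedSubmodule.toSubmodule_orthogonal_eq]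

theorem eq_graph {W : ClosedSubmodule ℂ H} (h : (proj V W).IsInvertible) :
    graph (proj Vᗮ W ∘L (proj V W).inverse) = W := by
  refine ClosedSubmodule.toSubmodule_injective (SetLike.coe_injective ?_)
  rw [coe_graph]
  ext y
  constructor
  · rintro ⟨x, rfl⟩
    have h1 := proj_add_proj_orthogonal V W ((proj V W).inverse x)
    rw [h.self_apply_inverse] at h1
    change (x : H) + (proj Vᗮ W ((proj V W).inverse x) : H) ∈ W.toSubmodule
    rw [h1]
    exact Subtype.mem _
  · intro hy
    refine ⟨proj V W ⟨y, hy⟩, ?_⟩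
    change (proj V W ⟨y, hy⟩ : H) + (proj Vᗮ W ((proj V W).inverse (proj V W ⟨y, hy⟩)) : H) = y
    rw [h.inverse_apply_self, proj_add_proj_orthogonal]

theorem chartDenom_eq (V W : ClosedSubmodule ℂ H) : chartDenom V W = proj V W ∘L proj W V := rfl

theorem chartNum_eq (V W : ClosedSubmodule ℂ H) : chartNum V W = proj Vᗮ W ∘L proj W V := rfl

theorem isInvertible_chartDenom {V W : ClosedSubmodule ℂ H} (h : (proj V W).IsInvertible) :
    (chartDenom V W).IsInvertible :=
  h.comp (isInvertible_proj_symm h)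

theorem chartNum_comp_inverse_chartDenom {V W : ClosedSubmodule ℂ H}
    (h : (proj V W).IsInvertible) :
    chartNum V W ∘L (chartDenom V W).inverse = proj Vᗮ W ∘L (proj V W).inverse := by
  rw [chartDenom_eq, chartNum_eq, h.inverse_comp_of_left]
  ext x
  simp [-ClosedSubmodule.toSubmodule_orthogonal_eq, (isInvertible_proj_symm h).self_apply_inverse]

end graph

/-! ### Membership in the restricted Grassmannian -/

section Gr

variable {H : Type*} [NormedAddCommGroup H] [InnerProductSpace ℂ H] [CompleteSpace H]
  {p : ℝ} {Hp : ClosedSubmodule ℂ H}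

open scoped LinearMap.FiniteRangeSetoid in
/-- A quasi-inverse `Ψ` of `pr_+|_V` shows that `pr_Vᗮ|_Hp` is, up to finite rank,
`pr_Vᗮ pr_+ Ψ = -pr_Vᗮ pr_- Ψ`. -/
theorem memSchatten_proj_orthogonal_left (hp : 1 ≤ p) (V : Gr p Hp) :
    MemSchatten p (proj (V.1)ᗮ Hp) := by
  obtain ⟨Ψ, -, hΨ⟩ := V.2.1.exists_isQuasiInverse
  set R := proj Hp V.1 ∘L Ψ - .id ℂ _ with hR
  have : FiniteDimensional ℂ R.range := by
    have h : IsNoetherian ℂ R.range := LinearMap.hasNoetherianRange_iff_range.mp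
      (LinearMap.FiniteRangeSetoid.equiv_iff_hasNoetherianRange.mp hΨ)
    infer_instance
  have h1 := proj_comp_proj_add (V.1)ᗮ Hp V.1
  rw [proj_orthogonal_self] at h1
  have h2 : proj (V.1)ᗮ Hp = (-1 : ℂ) • (proj (V.1)ᗮ Hp ∘L R) +
      (-1 : ℂ) • (proj (V.1)ᗮ Hpᗮ ∘L proj Hpᗮ V.1 ∘L Ψ) := by
    have h3 : (proj (V.1)ᗮ Hp ∘L proj Hp V.1) ∘L Ψ +
        (proj (V.1)ᗮ Hpᗮ ∘L proj Hpᗮ V.1) ∘L Ψ = 0 := by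
      rw [← ContinuousLinearMap.add_comp, h1, ContinuousLinearMap.zero_comp]
    rw [hR, ContinuousLinearMap.comp_sub, ContinuousLinearMap.comp_id,
      ← ContinuousLinearMap.comp_assoc, ← ContinuousLinearMap.comp_assoc,
      eq_neg_of_add_eq_zero_left h3]
    module
  rw [h2]
  exact ((memSchatten_of_finiteDimensional_range hp R).clm_comp hp _ |>.smul hp _).add hp
    ((V.2.2.comp_comp hp _ _).smul hp _)

theorem memSchatten_proj_orthogonal (hp : 1 ≤ p) (V W : Gr p Hp) :
    MemSchatten p (proj (V.1)ᗮ W.1) := by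
  rw [← proj_comp_proj_add (V.1)ᗮ Hp W.1]
  exact ((memSchatten_proj_orthogonal_left hp V).comp_clm hp _).add hp (W.2.2.clm_comp hp _)

/-- The graph of an `L_p` operator `V → Vᗮ`, as an element of the Grassmannian. -/
def graphGr [hp : Fact (1 ≤ p)] (V : Gr p Hp) (A : Model p V.1) : Gr p Hp := by
  refine ⟨graph A.toCLM, ?_, ?_⟩
  · rw [proj_graph]
    have hK : IsCompactOperator (proj Hp (V.1)ᗮ ∘L A.toCLM) :=
      isCompactOperator_of_mem (by linarith [hp.out]) (A.2.clm_comp hp.out _)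
    exact (V.2.1.add_isCompactOperator hK).comp_equiv _
  · rw [proj_graph]
    exact (V.2.2.add hp.out (A.2.clm_comp hp.out _)).comp_clm hp.out _

/-- The chart at `V`, as an everywhere defined map: `W ↦ pr_Vᗮ|_W ∘ (pr_V|_W)⁻¹`. -/
def chartFun [hp : Fact (1 ≤ p)] (V W : Gr p Hp) : Model p V.1 :=
  ⟨proj (V.1)ᗮ W.1 ∘L (proj V.1 W.1).inverse,
    (memSchatten_proj_orthogonal hp.out V W).comp_clm hp.out _⟩

variable [hp : Fact (1 ≤ p)]

theorem graphGr_mem_Omega (V : Gr p Hp) (A : Model p V.1) : graphGr V A ∈ Omega V :=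
  isInvertible_proj_graph A.toCLM

theorem graphGr_chartFun {V W : Gr p Hp} (hW : W ∈ Omega V) : graphGr V (chartFun V W) = W :=
  Subtype.ext (eq_graph hW)

theorem toCLM_chartFun_graphGr (E V : Gr p Hp) (A : Model p E.1) :
    (chartFun V (graphGr E A)).toCLM =
      (proj (V.1)ᗮ E.1 + proj (V.1)ᗮ (E.1)ᗮ ∘L A.toCLM) ∘L
        (proj V.1 E.1 + proj V.1 (E.1)ᗮ ∘L A.toCLM).inverse :=
  proj_comp_inverse_graph A.toCLM V.1

theorem chartFun_graphGr (V : Gr p Hp) (A : Model p V.1) : chartFun V (graphGr V A) = A := by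
  refine SchattenClass.ext ?_
  rw [toCLM_chartFun_graphGr, proj_orthogonal_self, proj_self, proj_self, proj_self_orthogonal]
  simp [-ClosedSubmodule.toSubmodule_orthogonal_eq]

theorem range_graphGr (V : Gr p Hp) : Set.range (graphGr V) = Omega V := by
  ext W
  refine ⟨?_, fun hW => ⟨_, graphGr_chartFun hW⟩⟩
  rintro ⟨A, rfl⟩
  exact graphGr_mem_Omega V A

theorem graphGr_mem_Omega_iff {E V : Gr p Hp} {A : Model p E.1} :
    graphGr E A ∈ Omega V ↔ (proj V.1 E.1 + proj V.1 (E.1)ᗮ ∘L A.toCLM).IsInvertible := by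
  rw [← proj_comp_graphEquiv, ContinuousLinearMap.isInvertible_comp_equiv]
  rfl

end Gr

end RestrictedGrassmannian

namespace RestrictedGrassmannian

open Schatten Topology

/-! ### Transition maps -/

variable {H : Type*} [NormedAddCommGroup H] [InnerProductSpace ℂ H] [CompleteSpace H]
  {p : ℝ} {Hp : ClosedSubmodule ℂ H} [hp : Fact (1 ≤ p)]

/-- The affine map `A ↦ a + b A` into the bounded operators `E → V`. -/
def denom (E V : Gr p Hp) (A : Model p E.1) : E.1.toSubmodule →L[ℂ] V.1.toSubmodule :=
  proj V.1 E.1 + proj V.1 (E.1)ᗮ ∘L A.toCLM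

/-- The operator `c = pr_Vᗮ|_E` as an element of `L_p(E, Vᗮ)`. -/
def lowerLeft (E V : Gr p Hp) : SchattenClass E.1.toSubmodule (V.1ᗮ).toSubmodule p :=
  ⟨proj (V.1)ᗮ E.1, memSchatten_proj_orthogonal hp.out V E⟩

/-- The affine map `A ↦ c + d A` into `L_p(E, Vᗮ)`. -/
def num (E V : Gr p Hp) (A : Model p E.1) : SchattenClass E.1.toSubmodule (V.1ᗮ).toSubmodule p :=
  lowerLeft E V + SchattenClass.compLeft E.1.toSubmodule p (proj (V.1)ᗮ (E.1)ᗮ) A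

theorem chartFun_graphGr_eq_compRight (E V : Gr p Hp) (A : Model p E.1) :
    chartFun V (graphGr E A) =
      SchattenClass.compRight p V.1.toSubmodule E.1.toSubmodule (V.1ᗮ).toSubmodule
        (denom E V A).inverse (num E V A) :=
  SchattenClass.ext (toCLM_chartFun_graphGr E V A)

theorem contDiff_denom (E V : Gr p Hp) {n : WithTop ℕ∞} : ContDiff ℂ n (denom E V) :=
  contDiff_const.add (contDiff_const.clm_comp
    (SchattenClass.toCLML E.1.toSubmodule (E.1ᗮ).toSubmodule p).contDiff)

theorem contDiff_num (E V : Gr p Hp) {n : WithTop ℕ∞} : ContDiff ℂ n (num E V) :=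
  contDiff_const.add (SchattenClass.compLeft E.1.toSubmodule p (proj (V.1)ᗮ (E.1)ᗮ)).contDiff

theorem isOpen_setOf_isInvertible_denom (E V : Gr p Hp) :
    IsOpen {A : Model p E.1 | (denom E V A).IsInvertible} := by
  have h : {A : Model p E.1 | (denom E V A).IsInvertible} = denom E V ⁻¹'
      Set.range ((↑) : (E.1.toSubmodule ≃L[ℂ] V.1.toSubmodule) → _) := rfl
  rw [h]
  exact (ContinuousLinearEquiv.isOpen).preimage (contDiff_denom E V (n := 0)).continuous

theorem analyticAt_chartFun_graphGr (E V : Gr p Hp) {A : Model p E.1}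
    (hA : (denom E V A).IsInvertible) :
    AnalyticAt ℂ (fun A => chartFun V (graphGr E A)) A := by
  simp_rw [chartFun_graphGr_eq_compRight]
  refine ContDiffAt.analyticAt ?_
  have h1 : ContDiffAt ℂ ⊤ (fun A => (denom E V A).inverse) A :=
    hA.contDiffAt_map_inverse.comp A (contDiff_denom E V).contDiffAt
  have h2 := (SchattenClass.compRight p V.1.toSubmodule E.1.toSubmodule
    (V.1ᗮ).toSubmodule).contDiff.contDiffAt.comp A h1
  exact h2.clm_apply (contDiff_num E V).contDiffAt

/-! ### The topology of the Grassmannian -/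

/-- The finest topology for which the parametrizations `A ↦ graph A` are continuous. -/
instance : TopologicalSpace (Gr p Hp) :=
  ⨆ V : Gr p Hp, TopologicalSpace.coinduced (graphGr V) inferInstance

theorem isOpen_iff_preimage_graphGr {U : Set (Gr p Hp)} :
    IsOpen U ↔ ∀ V : Gr p Hp, IsOpen (graphGr V ⁻¹' U) := by
  rw [isOpen_iSup_iff]
  rfl

theorem continuous_iff_comp_graphGr {X : Type*} [TopologicalSpace X] {f : Gr p Hp → X} :
    Continuous f ↔ ∀ V : Gr p Hp, Continuous (f ∘ graphGr V) := by
  rw [continuous_iSup_dom]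
  simp_rw [continuous_coinduced_dom]

theorem isOpenEmbedding_graphGr (E : Gr p Hp) : IsOpenEmbedding (graphGr E) := by
  refine .of_continuous_injective_isOpenMap (continuous_iff_comp_graphGr.mp continuous_id E)
    (Function.LeftInverse.injective (chartFun_graphGr E)) fun O hO => ?_
  refine isOpen_iff_preimage_graphGr.mpr fun V => ?_
  -- The preimage under another parametrization is the preimage of `O` under a transition map.
  have h : graphGr V ⁻¹' (graphGr E '' O) =
      {A | (denom V E A).IsInvertible} ∩ (fun A => chartFun E (graphGr V A)) ⁻¹' O := by
    ext A
    constructor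
    · rintro ⟨B, hB, hBA⟩
      refine ⟨graphGr_mem_Omega_iff.mp ?_, ?_⟩
      · rw [← hBA]; exact graphGr_mem_Omega E B
      · change chartFun E (graphGr V A) ∈ O
        rwa [← hBA, chartFun_graphGr]
    · rintro ⟨h1, h2⟩
      exact ⟨_, h2, graphGr_chartFun (graphGr_mem_Omega_iff.mpr h1)⟩
  rw [h]
  exact ContinuousOn.isOpen_inter_preimage
    (fun A hA => (analyticAt_chartFun_graphGr V E hA).continuousAt.continuousWithinAt)
    (isOpen_setOf_isInvertible_denom V E) hO

/-- If `G : E → H` is an isomorphism onto a closed subspace `W`, then the orthogonal projection onto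
`W` is `G (G* G)⁻¹ G*`. -/
theorem starProjection_eq_of_equiv {E : Type*} [NormedAddCommGroup E] [InnerProductSpace ℂ E]
    [CompleteSpace E] {W : Submodule ℂ H} [CompleteSpace W] (g : E ≃L[ℂ] W) {G : E →L[ℂ] H}
    (hG : G = W.subtypeL ∘L (g : E →L[ℂ] W)) :
    (ContinuousLinearMap.adjoint G ∘L G).IsInvertible ∧
      W.starProjection =
        G ∘L (ContinuousLinearMap.adjoint G ∘L G).inverse ∘L ContinuousLinearMap.adjoint G := by
  obtain ⟨g', hg'⟩ : ∃ g' : E →L[ℂ] W, g' = g := ⟨_, rfl⟩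
  have hginv : g'.IsInvertible := ⟨g, hg'.symm⟩
  have hga : (ContinuousLinearMap.adjoint g').IsInvertible := by
    refine .of_inverse (g := ContinuousLinearMap.adjoint g'.inverse) ?_ ?_
    · rw [← ContinuousLinearMap.adjoint_comp, hginv.inverse_comp_self,
        ContinuousLinearMap.adjoint_id]
    · rw [← ContinuousLinearMap.adjoint_comp, hginv.self_comp_inverse,
        ContinuousLinearMap.adjoint_id]
  rw [← hg'] at hG
  have hadj : ContinuousLinearMap.adjoint G =
      ContinuousLinearMap.adjoint g' ∘L W.orthogonalProjectionOnto := by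
    rw [hG, ContinuousLinearMap.adjoint_comp, Submodule.adjoint_subtypeL]
  have hGG : ContinuousLinearMap.adjoint G ∘L G = ContinuousLinearMap.adjoint g' ∘L g' := by
    rw [hadj, hG]
    ext x
    simp
  refine ⟨hGG ▸ hga.comp hginv, ?_⟩
  rw [hGG, hga.inverse_comp_of_left, hadj, hG]
  ext x
  simp [hga.inverse_apply_self, hginv.self_apply_inverse]

/-- The orthogonal projection onto the graph of `A` is `G (G* G)⁻¹ G*` with `G x = x + A x`, which
depends continuously on `A`. -/
theorem continuous_starProjection :
    Continuous fun W : Gr p Hp => W.1.toSubmodule.starProjection := by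
  refine continuous_iff_comp_graphGr.mpr fun V => ?_
  set G : Model p V.1 → (V.1.toSubmodule →L[ℂ] H) := fun A =>
    V.1.toSubmodule.subtypeL + (V.1ᗮ).toSubmodule.subtypeL ∘L A.toCLM with hG
  have hGc : Continuous G := continuous_const.add (continuous_const.clm_comp
    (SchattenClass.toCLML V.1.toSubmodule (V.1ᗮ).toSubmodule p).continuous)
  have hGa : Continuous fun A => ContinuousLinearMap.adjoint (G A) :=
    ContinuousLinearMap.adjoint.continuous.comp hGc
  have key := fun A : Model p V.1 =>
    starProjection_eq_of_equiv (graphEquiv A.toCLM) (G := G A) rfl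
  have heq : (fun W : Gr p Hp => W.1.toSubmodule.starProjection) ∘ graphGr V = fun A =>
      G A ∘L (ContinuousLinearMap.adjoint (G A) ∘L G A).inverse ∘L
        ContinuousLinearMap.adjoint (G A) := funext fun A => (key A).2
  rw [heq]
  refine hGc.clm_comp (Continuous.clm_comp ?_ hGa)
  refine continuous_iff_continuousAt.mpr fun A => ?_
  exact ((key A).1.contDiffAt_map_inverse (𝕜 := ℂ) (n := 0)).continuousAt.comp
    (f := fun A => ContinuousLinearMap.adjoint (G A) ∘L G A) (hGa.clm_comp hGc).continuousAt

theorem injective_starProjection :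
    Function.Injective fun W : Gr p Hp => W.1.toSubmodule.starProjection := fun V W h => by
  refine Subtype.ext (ClosedSubmodule.toSubmodule_injective ?_)
  rw [← Submodule.range_starProjection V.1.toSubmodule,
    ← Submodule.range_starProjection W.1.toSubmodule]
  exact congrArg (fun T : H →L[ℂ] H => T.range) h

instance : T2Space (Gr p Hp) :=
  .of_injective_continuous injective_starProjection continuous_starProjection

/-- The chart at `V`: the inverse of the open embedding `A ↦ graph A`. -/
def chart (V : Gr p Hp) : OpenPartialHomeomorph (Gr p Hp) (Model p V.1) :=
  ((isOpenEmbedding_graphGr V).toOpenPartialHomeomorph (graphGr V)).symm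

theorem chart_symm_apply (V : Gr p Hp) (A : Model p V.1) : (chart V).symm A = graphGr V A := rfl

theorem chart_source (V : Gr p Hp) : (chart V).source = Omega V := by
  rw [← range_graphGr]
  simp [chart]

theorem chart_target (V : Gr p Hp) : (chart V).target = Set.univ := rfl

theorem chart_apply {V W : Gr p Hp} (hW : W ∈ Omega V) : chart V W = chartFun V W := by
  rw [← (chart V).eq_symm_apply (by rwa [chart_source]) (Set.mem_univ _), chart_symm_apply,
    graphGr_chartFun hW]

theorem chart_transition_source (E V : Gr p Hp) :
    ((chart E).symm.trans (chart V)).source = {A | (denom E V A).IsInvertible} := by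
  ext A
  rw [OpenPartialHomeomorph.trans_source]
  simp [chart_target, chart_source, chart_symm_apply, graphGr_mem_Omega_iff, denom]

theorem analyticOnNhd_chart_transition (E V : Gr p Hp) :
    AnalyticOnNhd ℂ ((chart E).symm.trans (chart V)) ((chart E).symm.trans (chart V)).source := by
  rw [chart_transition_source]
  intro A hA
  refine (analyticAt_chartFun_graphGr E V hA).congr ?_
  filter_upwards [(isOpen_setOf_isInvertible_denom E V).mem_nhds hA] with B hB
  exact (chart_apply (graphGr_mem_Omega_iff.mpr hB)).symm

variable (p Hp) in
/-- The analytic atlas of the Grassmannian, with one chart for each of its elements. -/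
def atlas : AnalyticBanachAtlas ℂ (Gr p Hp) (fun V : Gr p Hp => Model p V.1) where
  complete _ := inferInstance
  chart := chart
  cover V := ⟨V, by
    rw [chart_source]
    change (proj V.1 V.1).IsInvertible
    rw [proj_self]
    exact ContinuousLinearMap.isInvertible_equiv (f := .refl ℂ _)⟩
  analytic_transition := analyticOnNhd_chart_transition

theorem chart_image (E V : Gr p Hp) :
    chart E '' (Omega E ∩ Omega V) = {A | (denom E V A).IsInvertible} := by
  ext A
  constructor
  · rintro ⟨W, ⟨hE, hV⟩, rfl⟩
    refine graphGr_mem_Omega_iff.mp ?_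
    rwa [chart_apply hE, graphGr_chartFun hE]
  · intro hA
    exact ⟨graphGr E A, ⟨graphGr_mem_Omega E A, graphGr_mem_Omega_iff.mpr hA⟩,
      by rw [chart_apply (graphGr_mem_Omega E A), chartFun_graphGr]⟩

end RestrictedGrassmannian

end

open RestrictedGrassmannian in
theorem mainTheorem7 {H : Type*} [NormedAddCommGroup H] [InnerProductSpace ℂ H] [CompleteSpace H]
    [TopologicalSpace.SeparableSpace H] (p : ℝ) [Fact (1 ≤ p)] (Hp : ClosedSubmodule ℂ H)
    (hplus : ¬ FiniteDimensional ℂ Hp.toSubmodule)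
    (hminus : ¬ FiniteDimensional ℂ (Hpᗮ).toSubmodule) :
    ∃ (_ : TopologicalSpace (Gr p Hp))
      (𝒜 : AnalyticBanachAtlas ℂ (Gr p Hp) (fun V : Gr p Hp => Model p V.1)),
      T2Space (Gr p Hp) ∧
      -- the chart at `V` is defined on `Ω_V`, given by the stated formula, onto `L_p(V, Vᗮ)`,
      -- and its inverse sends an operator to its graph
      (∀ V : Gr p Hp,
        (𝒜.chart V).source = Omega V ∧
        (𝒜.chart V).target = Set.univ ∧
        (∀ W ∈ Omega V, (chartDenom V.1 W.1).IsInvertible ∧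
          (𝒜.chart V W).toCLM = chartNum V.1 W.1 ∘L (chartDenom V.1 W.1).inverse) ∧
        ∀ A : Model p V.1, (((𝒜.chart V).symm A).1 : Set H) =
          Set.range fun x : V.1.toSubmodule => (x : H) + (A.toCLM x : H)) ∧
      -- the transition maps, for `a = pr_V|_E`, `b = pr_V|_Eᗮ`, `c = pr_Vᗮ|_E`, `d = pr_Vᗮ|_Eᗮ`
      ∀ E V : Gr p Hp,
        𝒜.chart E '' (Omega E ∩ Omega V) =
          {A | (proj V.1 E.1 + proj V.1 (E.1)ᗮ ∘L A.toCLM).IsInvertible} ∧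
        ∀ A ∈ 𝒜.chart E '' (Omega E ∩ Omega V),
          (𝒜.chart V ((𝒜.chart E).symm A)).toCLM =
            (proj (V.1)ᗮ E.1 + proj (V.1)ᗮ (E.1)ᗮ ∘L A.toCLM) ∘L
              (proj V.1 E.1 + proj V.1 (E.1)ᗮ ∘L A.toCLM).inverse := by
  refine ⟨inferInstance, atlas p Hp, inferInstance, fun V => ⟨chart_source V, chart_target V,
    fun W hW => ⟨isInvertible_chartDenom hW, ?_⟩, fun A => coe_graph A.toCLM⟩,
    fun E V => ⟨chart_image E V, fun A hA => ?_⟩⟩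
  · rw [chartNum_comp_inverse_chartDenom hW]
    exact congrArg Schatten.SchattenClass.toCLM (chart_apply hW)
  · have hA' : graphGr E A ∈ Omega V := graphGr_mem_Omega_iff.mpr ((chart_image E V).le hA)
    rw [← toCLM_chartFun_graphGr]
    exact congrArg Schatten.SchattenClass.toCLM (chart_apply hA')
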